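/- **Lemma (Attenuation operators).** A *rounding promise* $M$ is a finite family of closed intervals $[a_x,b_x]\subseteq[0,1]$, $x=0,\dots,s-1$ ($s=s^{(M)}\ge 1$), with $b_x<a_{x+1}$, $a_0=0$ and $b_{s-1}=1$; $\lambda\in M$ means that $\lambda$ lies in one of the intervals. Let $\kappa>0$ and suppose that every interval of $M$ and every gap $(b_x,a_{x+1})$ has width at least $\kappa$. Let $\delta_{\mathrm{leak}}>0$ and let $\gamma>0$ with $\kappa\gamma\le 1$ (for instance $0<\gamma\le 1$). Let $M^T$ be the union of the truncated intervals $[a_x+\kappa\gamma,\,b_x-\kappa\gamma]$ (empty ones contributing nothing). Then there are functions $a^{(M)},\tilde a^{(M)}:[0,1]\to[0,1]$ (depending on $M,\kappa,\gamma,\delta_{\mathrm{leak}}$ only) such that for every $\lambda\in[0,1]$: - if $\lambda\notin M$, then $a^{(M)}(\lambda)=0$ and $\tilde a^{(M)}(\lambda)\le\delta_{\mathrm{leak}}$; - if $\lambda\in M^T$, then $a^{(M)}(\lambda)=1$ and $\tilde a^{(M)}(\lambda)\ge 1-\delta_{\mathrm{leak}}$; - otherwise $a^{(M)}(\lambda)=\tilde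 a^{(M)}(\lambda)$. Moreover, for every Hermitian matrix $H=\sum_i\lambda_i\Pi_i$ (with distinct eigenvalues $\lambda_i$ and eigenprojectors $\Pi_i$) whose spectrum is contained in $[0,1]$, the operators $A^{(M)}=\sum_i a^{(M)}(\lambda_i)\Pi_i$ and $\tilde A^{(M)}=\sum_i\tilde a^{(M)}(\lambda_i)\Pi_i$ commute with $H$ and satisfy $\|A^{(M)}-\tilde A^{(M)}\|\le\delta_{\mathrm{leak}}$ (spectral norm) and $\|A^{(M)}(I-P^{(M)})\|=0$, where $P^{(M)}=\sum_x\sum_{i:\lambda_i\in[a_x,b_x]}\Pi_i$. Finally, a block encoding of $A$ with $k$ ancilla qubits is a unitary $U$ on $k$ qubits and the system with $A=(\langle 0^k|\otimes I)\,U\,(|0^k\rangle\otimes I)$. There is a universal constant $C$ such that, for every $k$, there is a quantum circuit, depending only on $M,\kappa,\gamma,\delta_{\mathrm{leak}},k$, which for every $H$ as above and every block encoding $U_H$ of $H$ with $k$ ancilla qubits implements a block encoding of $\tilde A^{(M)}$. With $$X=\kappa^{-1}\gamma^{-1}\max\{0,\log(s^{(M)}/\delta_{\mathrm{leak}})\},$$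 it makes at most $C\,X$ uses of $U_H$ or $U_H^\dagger$ (each possibly controlled), and its total number of gates (uses of $U_H^{\pm1}$ together with one- and two-qubit gates) is at most $C\,(k+1)\,X$. In particular, for block encodings of $H$ with a fixed number of ancillas the circuit complexity is $O(\kappa^{-1}\gamma^{-1}\log(s^{(M)}/\delta_{\mathrm{leak}}))$. -/

import Mathlib

open scoped Matrix Kronecker Matrix.Norms.L2Operator

noncomputable section

/-! ### Rounding promises -/

/-- A rounding promise: finitely many closed subintervals `[left x, right x]` of `[0, 1]`, listed
from left to right and pairwise separated; the first starts at `0` and the last ends at `1`. -/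
structure RoundingPromise where
  /-- the number of intervals -/
  s : ℕ
  s_pos : 0 < s
  left : Fin s → ℝ
  right : Fin s → ℝ
  left_le_right : ∀ x, left x ≤ right x
  subset_unit : ∀ x, Set.Icc (left x) (right x) ⊆ Set.Icc 0 1
  right_lt_left : ∀ x y : Fin s, x.val + 1 = y.val → right x < left y
  left_first : left ⟨0, s_pos⟩ = 0
  right_last : right ⟨s - 1, Nat.sub_lt s_pos Nat.one_pos⟩ = 1

namespace RoundingPromise

/-- The union of all the intervals: `lam ∈ M.union` is what is meant by `lam ∈ M`. -/
def union (M : RoundingPromise) : Set ℝ := ⋃ x, Set.Icc (M.left x) (M.right x)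

/-- The union of the intervals of the promise truncated by `w` on both sides of each interval. -/
def truncatedUnion (M : RoundingPromise) (w : ℝ) : Set ℝ :=
  ⋃ x, Set.Icc (M.left x + w) (M.right x - w)

/-- All intervals and all gaps between adjacent intervals have width at least `κ`. -/
def WidthsAtLeast (M : RoundingPromise) (κ : ℝ) : Prop :=
  (∀ x, κ ≤ M.right x - M.left x) ∧
    ∀ x y : Fin M.s, x.val + 1 = y.val → κ ≤ M.left y - M.right x

end RoundingPromise

/-! ### Spectral decompositions -/

section Spectral

variable {ι : Type*} [Fintype ι] [DecidableEq ι] {H : Matrix ι ι ℂ}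

/-- The finite set of distinct eigenvalues of a Hermitian matrix. -/
def energies (hH : H.IsHermitian) : Finset ℝ := Finset.univ.image hH.eigenvalues

/-- The orthogonal projector onto the eigenspace of `H` for `lam` (zero if `lam` is not an
eigenvalue), as the sum of `|v⟩⟨v|` over an orthonormal basis of that eigenspace. -/
def eigenProj (hH : H.IsHermitian) (lam : ℝ) : Matrix ι ι ℂ :=
  ∑ i with hH.eigenvalues i = lam,
    Matrix.vecMulVec (hH.eigenvectorBasis i).ofLp (star (hH.eigenvectorBasis i).ofLp)

/-- The operator `∑ᵢ f(λᵢ) Πᵢ`, the sum running over the distinct eigenvalues of `H`. -/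
def spectralOp (hH : H.IsHermitian) (f : ℝ → ℝ) : Matrix ι ι ℂ :=
  ∑ lam ∈ energies hH, (f lam : ℂ) • eigenProj hH lam

open Classical in
/-- The projector onto the eigenspaces with eigenvalue in the `x`-th interval of `M`. -/
def promisedEigenProj (hH : H.IsHermitian) (M : RoundingPromise) (x : Fin M.s) : Matrix ι ι ℂ :=
  ∑ lam ∈ energies hH with lam ∈ Set.Icc (M.left x) (M.right x), eigenProj hH lam

/-- The promised subspace projector. -/
def promisedProj (hH : H.IsHermitian) (M : RoundingPromise) : Matrix ι ι ℂ :=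
  ∑ x, promisedEigenProj hH M x

end Spectral

/-! ### Block encodings and circuits with a block encoding as an oracle -/

/-- Computational basis states of `q` qubits. -/
abbrev Bits (q : ℕ) : Type := Fin q → Bool

section Circuits

variable {ι : Type*} [Fintype ι] [DecidableEq ι]

/-- `U`, a unitary on `k` ancilla qubits and the system, is a block encoding of `A`:
`A = (⟨0ᵏ| ⊗ I) U (|0ᵏ⟩ ⊗ I)`. -/
def IsBlockEncoding {k : ℕ} (U : Matrix (Bits k × ι) (Bits k × ι) ℂ) (A : Matrix ι ι ℂ) : Prop :=
  U ∈ Matrix.unitaryGroup (Bits k × ι) ℂ ∧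
    A = Matrix.of fun s t => U ((fun _ => false), s) ((fun _ => false), t)

/-- Apply `V` to the wires `w 0, …, w (m-1)` and the system, and the identity to all other wires. -/
def applyOn {m q : ℕ} (w : Fin m ↪ Fin q) (V : Matrix (Bits m × ι) (Bits m × ι) ℂ) :
    Matrix (Bits q × ι) (Bits q × ι) ℂ :=
  Matrix.of fun x y =>
    if ∀ i, (∀ j, w j ≠ i) → x.1 i = y.1 i then V (x.1 ∘ w, x.2) (y.1 ∘ w, y.2) else 0

/-- `|0⟩⟨0| ⊗ I + |1⟩⟨1| ⊗ V`, with qubit `0` as the control. -/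
def controlled {k : ℕ} (V : Matrix (Bits k × ι) (Bits k × ι) ℂ) :
    Matrix (Bits (k + 1) × ι) (Bits (k + 1) × ι) ℂ :=
  Matrix.of fun x y =>
    if x.1 0 = y.1 0 then
      (if x.1 0 = true then V else 1) (Fin.tail x.1, x.2) (Fin.tail y.1, y.2)
    else 0

/-- The gates of a circuit on `q` ancilla qubits and a system, with oracle access to a unitary on
`k` qubits and the system. The flag `inv` says whether the oracle or its inverse is applied.
The system is touched by the oracle only. -/
inductive Gate (k q : ℕ) : Type
  /-- an arbitrary one- or two-qubit gate -/
  | elementary {m : ℕ} (hm : m = 1 ∨ m = 2) (w : Fin m ↪ Fin q)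
      (g : Matrix.unitaryGroup (Bits m) ℂ) : Gate k q
  /-- one use of the oracle or its inverse -/
  | query (inv : Bool) (w : Fin k ↪ Fin q) : Gate k q
  /-- one use of the oracle or its inverse, controlled on the qubit `w 0` -/
  | controlledQuery (inv : Bool) (w : Fin (k + 1) ↪ Fin q) : Gate k q

namespace Gate

variable {k q : ℕ}

/-- The operator that a gate implements when the oracle is `U`. -/
def eval (U : Matrix (Bits k × ι) (Bits k × ι) ℂ) :
    Gate k q → Matrix (Bits q × ι) (Bits q × ι) ℂ
  | elementary _ w g => applyOn w ((g : Matrix _ _ ℂ) ⊗ₖ (1 : Matrix ι ι ℂ))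
  | query inv w => applyOn w (if inv then Uᴴ else U)
  | controlledQuery inv w => applyOn w (controlled (if inv then Uᴴ else U))

/-- Whether a gate is a use of the (possibly inverse, possibly controlled) oracle. -/
def isQuery : Gate k q → Bool
  | elementary _ _ _ => false
  | query _ _ => true
  | controlledQuery _ _ => true

end Gate

/-- A circuit is a finite list of gates; the head of the list is applied first. -/
abbrev Circuit (k q : ℕ) : Type := List (Gate k q)

namespace Circuit

variable {k q : ℕ}

/-- The operator that a circuit implements when the oracle is `U`. -/
def eval (U : Matrix (Bits k × ι) (Bits k × ι) ℂ) :
    Circuit k q → Matrix (Bits q × ι) (Bits q × ι) ℂ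
  | [] => 1
  | g :: c => eval U c * g.eval U

/-- The number of uses of the oracle. -/
def queryCount (c : Circuit k q) : ℕ := c.countP Gate.isQuery

/-- The total number of gates: one- and two-qubit gates and uses of the oracle. -/
def size (c : Circuit k q) : ℕ := c.length

end Circuit

end Circuits

end

/-! ### Functional calculus of a Hermitian matrix -/

/-! ### Order and disjointness of the intervals. -/

namespace RoundingPromise

/-! The function `a'` is a polynomial `p` in `2 λ² - 1`, and `a` is `a'` overwritten by the exact
values 0 and 1 outside the transition regions (`sharpen`). Two constructions carry the proof.

Approximation. Put `2 λ² - 1 = cos φ` and `z = exp (i φ)`, so that `λ = |1 + z| / 2`, and let `w = κ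
γ`. The indicator function of the promise truncated by `w / 2` is averaged over a grid of `N`-th
roots of unity against the kernel `|b (z ζ ^ j)|²`, where `b` is the `m`-th power of `(1 + X + ⋯ + X
^ (n - 1)) / n`. By Parseval the total mass of the kernel is the same for every `z`, and once `n ≥
16 / w` the mass at distance at least `w` decays exponentially in `m`. One averaging smooths all the
jumps at once, so the degree `m n = O(w⁻¹ log (1 / δ))` does not involve the number of intervals
(`exists_polynomial_approx`).

Implementation. Let `R` be the reflection about the zero state of the ancillas and `W = R Uᴴ R U`.
On that state `(W + W⁻¹) / 2` acts as `2 H² - 1` (`walk_add_walkInv_mul_ancillaZero`), so `p (2 H² -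
1)` is a compression of `A(W) W ^ (-D)` with `A(z) = z ^ D p ((z + z⁻¹) / 2)`. As `|p| < 1` on `[-1,
1]`, Fejér–Riesz (`exists_norm_sq_eval_eq`) supplies `B` with `|A|² + |B|² = 1` on the unit circle,
and every such pair arises from alternating rotations of a signal qubit with controlled `W`
(`reachable_of_norm_sq_add_norm_sq`). Each `W` costs two queries and `O(k + 1)` gates.

When `s = 1` or `δ ≥ 1`, the constant function 1 and the empty circuit suffice. Otherwise `log (2 /
δ) ≤ log (s / δ)`, and the latter is bounded away from zero, so rounding the parameters up costs
only a constant factor. -/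

theorem right_lt_left_of_lt (M : RoundingPromise) {x y : Fin M.s} (h : x < y) :
    M.right x < M.left y := by
  obtain ⟨x, hx⟩ := x
  obtain ⟨y, hy⟩ := y
  obtain ⟨d, rfl⟩ := Nat.exists_eq_add_of_lt (Fin.mk_lt_mk.mp h)
  induction d with
  | zero => exact M.right_lt_left _ _ rfl
  | succ d ih =>
    have hy' : x + d + 1 < M.s := by omega
    have h1 := ih hy' (Fin.mk_lt_mk.mpr (by omega))
    have h2 := M.left_le_right ⟨x + d + 1, hy'⟩
    have h3 := M.right_lt_left ⟨x + d + 1, hy'⟩ ⟨x + (d + 1) + 1, hy⟩ (by simp; omega)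
    linarith

theorem eq_of_mem_Icc (M : RoundingPromise) {x y : Fin M.s} {lam : ℝ}
    (hx : lam ∈ Set.Icc (M.left x) (M.right x)) (hy : lam ∈ Set.Icc (M.left y) (M.right y)) :
    x = y := by
  rcases lt_trichotomy x y with h | h | h
  · have := M.right_lt_left_of_lt h
    linarith [hx.2, hy.1]
  · exact h
  · have := M.right_lt_left_of_lt h
    linarith [hy.2, hx.1]

end RoundingPromise

section SpectralCalculus

variable {ι : Type*} [Fintype ι] [DecidableEq ι] {H : Matrix ι ι ℂ}

/-- Grouping the eigenvectors by eigenvalue removes the projectors; the algebraic rules below are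
then rules for diagonal matrices. -/
theorem spectralOp_eq (hH : H.IsHermitian) (f : ℝ → ℝ) :
    spectralOp hH f = (hH.eigenvectorUnitary : Matrix ι ι ℂ) *
      Matrix.diagonal (fun i => (f (hH.eigenvalues i) : ℂ)) *
        (hH.eigenvectorUnitary : Matrix ι ι ℂ)ᴴ := by
  have h : spectralOp hH f = ∑ i, (f (hH.eigenvalues i) : ℂ) •
      Matrix.vecMulVec (hH.eigenvectorBasis i).ofLp (star (hH.eigenvectorBasis i).ofLp) := by
    rw [spectralOp, ← Finset.sum_fiberwise_of_maps_to (s := Finset.univ) (t := energies hH)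
      (g := hH.eigenvalues) (fun i hi => Finset.mem_image_of_mem _ hi)]
    refine Finset.sum_congr rfl fun lam _ => ?_
    rw [eigenProj, Finset.smul_sum]
    refine Finset.sum_congr rfl fun i hi => ?_
    rw [(Finset.mem_filter.mp hi).2]
  rw [h]
  ext a b
  rw [Matrix.mul_apply]
  simp only [Matrix.sum_apply, Matrix.smul_apply, Matrix.vecMulVec_apply, Matrix.mul_diagonal,
    Matrix.conjTranspose_apply, Matrix.IsHermitian.eigenvectorUnitary_apply,
    Pi.star_apply, smul_eq_mul]
  exact Finset.sum_congr rfl fun i _ => by ring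

theorem eigenvectorUnitary_conjTranspose_mul (hH : H.IsHermitian) :
    (hH.eigenvectorUnitary : Matrix ι ι ℂ)ᴴ * (hH.eigenvectorUnitary : Matrix ι ι ℂ) = 1 :=
  Matrix.mem_unitaryGroup_iff'.mp hH.eigenvectorUnitary.2

theorem eigenvectorUnitary_mul_conjTranspose (hH : H.IsHermitian) :
    (hH.eigenvectorUnitary : Matrix ι ι ℂ) * (hH.eigenvectorUnitary : Matrix ι ι ℂ)ᴴ = 1 :=
  Matrix.mem_unitaryGroup_iff.mp hH.eigenvectorUnitary.2

theorem spectralOp_id (hH : H.IsHermitian) : spectralOp hH (fun lam => lam) = H := by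
  rw [spectralOp_eq]
  conv_rhs => rw [hH.spectral_theorem, Unitary.conjStarAlgAut_apply]
  rfl

theorem spectralOp_congr (hH : H.IsHermitian) {f g : ℝ → ℝ}
    (h : ∀ i, f (hH.eigenvalues i) = g (hH.eigenvalues i)) : spectralOp hH f = spectralOp hH g := by
  simp only [spectralOp_eq, h]

theorem spectralOp_mul (hH : H.IsHermitian) (f g : ℝ → ℝ) :
    spectralOp hH f * spectralOp hH g = spectralOp hH (fun lam => f lam * g lam) := by
  simp only [spectralOp_eq, Complex.ofReal_mul, ← Matrix.diagonal_mul_diagonal]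
  set V := (hH.eigenvectorUnitary : Matrix ι ι ℂ)
  simp only [Matrix.mul_assoc]
  rw [← Matrix.mul_assoc Vᴴ V, eigenvectorUnitary_conjTranspose_mul, Matrix.one_mul]

theorem spectralOp_add (hH : H.IsHermitian) (f g : ℝ → ℝ) :
    spectralOp hH f + spectralOp hH g = spectralOp hH (fun lam => f lam + g lam) := by
  simp only [spectralOp_eq, Complex.ofReal_add, ← Matrix.diagonal_add, Matrix.mul_add,
    Matrix.add_mul]

theorem spectralOp_sub (hH : H.IsHermitian) (f g : ℝ → ℝ) :
    spectralOp hH f - spectralOp hH g = spectralOp hH (fun lam => f lam - g lam) := by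
  rw [sub_eq_iff_eq_add, spectralOp_add]
  simp

theorem spectralOp_const (hH : H.IsHermitian) (r : ℝ) :
    spectralOp hH (fun _ => r) = (r : ℂ) • 1 := by
  rw [spectralOp_eq, ← Matrix.smul_one_eq_diagonal, Matrix.mul_smul, Matrix.mul_one,
    Matrix.smul_mul, eigenvectorUnitary_mul_conjTranspose]

theorem commute_spectralOp (hH : H.IsHermitian) (f : ℝ → ℝ) : Commute (spectralOp hH f) H := by
  have h : Commute (spectralOp hH f) (spectralOp hH fun lam => lam) := by
    rw [Commute, SemiconjBy, spectralOp_mul, spectralOp_mul]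
    simp only [mul_comm]
  rwa [spectralOp_id] at h

theorem norm_spectralOp_le (hH : H.IsHermitian) (f : ℝ → ℝ) {r : ℝ} (hr : 0 ≤ r)
    (h : ∀ i, |f (hH.eigenvalues i)| ≤ r) : ‖spectralOp hH f‖ ≤ r := by
  rw [spectralOp_eq]
  have hV : ‖(hH.eigenvectorUnitary : Matrix ι ι ℂ)‖ ≤ 1 := by
    -- A unitary has norm one only on a nonzero space; for empty `ι` the norm is 0.
    rcases isEmpty_or_nonempty ι with hι | hι
    · rw [Subsingleton.elim (hH.eigenvectorUnitary : Matrix ι ι ℂ) 0, norm_zero]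
      exact zero_le_one
    · exact (CStarRing.norm_coe_unitary _).le
  have hD : ‖Matrix.diagonal (fun i => (f (hH.eigenvalues i) : ℂ))‖ ≤ r := by
    rw [Matrix.l2_opNorm_diagonal, pi_norm_le_iff_of_nonneg hr]
    intro i
    simpa using h i
  calc _ ≤ ‖(hH.eigenvectorUnitary : Matrix ι ι ℂ)‖ *
        ‖Matrix.diagonal (fun i => (f (hH.eigenvalues i) : ℂ))‖ *
        ‖(hH.eigenvectorUnitary : Matrix ι ι ℂ)ᴴ‖ :=
      (Matrix.l2_opNorm_mul _ _).trans
        (mul_le_mul_of_nonneg_right (Matrix.l2_opNorm_mul _ _) (norm_nonneg _))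
    _ ≤ 1 * r * 1 := by
      rw [Matrix.l2_opNorm_conjTranspose]
      gcongr
    _ = r := by ring

open Classical in
theorem promisedProj_eq (hH : H.IsHermitian) (M : RoundingPromise) :
    promisedProj hH M = spectralOp hH (fun lam => if lam ∈ M.union then 1 else 0) := by
  rw [promisedProj, spectralOp]
  simp only [promisedEigenProj, Finset.sum_filter]
  rw [Finset.sum_comm]
  refine Finset.sum_congr rfl fun lam _ => ?_
  split_ifs with h
  · obtain ⟨x, hx⟩ := Set.mem_iUnion.mp h
    rw [Finset.sum_eq_single x]
    · simp only [hx, if_true, Complex.ofReal_one, one_smul]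
    · intro y _ hy
      rw [if_neg fun h' => hy (M.eq_of_mem_Icc h' hx)]
    · simp
  · rw [Complex.ofReal_zero, zero_smul]
    refine Finset.sum_eq_zero fun x _ => if_neg fun hx => h (Set.mem_iUnion.mpr ⟨x, hx⟩)

theorem spectralOp_mul_one_sub_promisedProj (hH : H.IsHermitian) (M : RoundingPromise) {f : ℝ → ℝ}
    (hf : ∀ i, hH.eigenvalues i ∉ M.union → f (hH.eigenvalues i) = 0) :
    spectralOp hH f * (1 - promisedProj hH M) = 0 := by
  classical
  rw [promisedProj_eq, Matrix.mul_sub, Matrix.mul_one, spectralOp_mul, spectralOp_sub]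
  rw [spectralOp_congr hH (g := fun _ => 0), spectralOp_const, Complex.ofReal_zero, zero_smul]
  intro i
  by_cases h : hH.eigenvalues i ∈ M.union
  · simp [h]
  · simp [hf i h]

theorem spectralOp_eval (hH : H.IsHermitian) (p : Polynomial ℝ) :
    spectralOp hH (fun lam => p.eval (2 * lam ^ 2 - 1)) =
      Polynomial.aeval ((2 : ℂ) • (H * H) - 1) (p.map Complex.ofRealHom) := by
  have hT : (2 : ℂ) • (H * H) - 1 = spectralOp hH (fun lam => 2 * lam ^ 2 - 1) := by
    have h1 : (1 : Matrix ι ι ℂ) = spectralOp hH (fun _ => 1) := by simp [spectralOp_const]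
    have h2 : (2 : ℂ) • (H * H) = spectralOp hH (fun lam => 2 * (lam * lam)) := by
      rw [← spectralOp_mul hH (fun _ => 2) (fun lam => lam * lam),
        ← spectralOp_mul hH (fun lam => lam) (fun lam => lam), spectralOp_id, spectralOp_const]
      simp
    rw [h2]
    conv_lhs => rw [h1]
    rw [spectralOp_sub]
    simp only [pow_two]
  rw [hT]
  induction p using Polynomial.induction_on' with
  | add p q hp hq =>
    simp only [Polynomial.eval_add, Polynomial.map_add, map_add]
    rw [← hp, ← hq, spectralOp_add]
  | monomial n r =>
    simp only [Polynomial.eval_monomial, Polynomial.map_monomial, Polynomial.aeval_monomial]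
    have hpow : ∀ n : ℕ, spectralOp hH (fun lam => 2 * lam ^ 2 - 1) ^ n =
        spectralOp hH (fun lam => (2 * lam ^ 2 - 1) ^ n) := by
      intro n
      induction n with
      | zero => simp [spectralOp_const]
      | succ n ih => rw [pow_succ, ih, spectralOp_mul]; simp only [pow_succ]
    rw [hpow, ← spectralOp_mul hH (fun _ => r), spectralOp_const, Algebra.algebraMap_eq_smul_one]
    rfl

end SpectralCalculus

/-! ### Operators acting on some of the wires -/

section ApplyOn

set_option linter.unusedSectionVars false

variable {ι : Type*} [Fintype ι] [DecidableEq ι] {m q k : ℕ}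

theorem extend_comp_wires (w : Fin m ↪ Fin q) (u : Bits m) (x : Bits q) :
    Function.extend w u x ∘ w = u :=
  funext fun j => w.injective.extend_apply u x j

theorem extend_of_agree (w : Fin m ↪ Fin q) {x y : Bits q}
    (h : ∀ i, (∀ j, w j ≠ i) → x i = y i) : Function.extend w (y ∘ w) x = y := by
  funext i
  by_cases hi : ∃ j, w j = i
  · obtain ⟨j, rfl⟩ := hi
    exact w.injective.extend_apply _ _ j
  · rw [Function.extend_apply' _ _ _ hi]
    exact h i fun j hj => hi ⟨j, hj⟩

/-- A basis state that agrees with `x` off the wires `w` is determined by its restriction to `w`.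
This turns products with `applyOn` into sums over the small register. -/
theorem sum_agree {R : Type*} [AddCommMonoid R] (w : Fin m ↪ Fin q) (x : Bits q) (f : Bits q → R) :
    ∑ y, (if ∀ i, (∀ j, w j ≠ i) → x i = y i then f y else 0) =
      ∑ u : Bits m, f (Function.extend w u x) := by
  rw [← Finset.sum_filter]
  refine Finset.sum_bij' (fun y _ => y ∘ w) (fun u _ => Function.extend w u x) ?_ ?_ ?_ ?_ ?_
  · exact fun _ _ => Finset.mem_univ _
  · intro u _
    refine Finset.mem_filter.mpr ⟨Finset.mem_univ _, fun i hi => ?_⟩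
    rw [Function.extend_apply' _ _ _ (by simpa using hi)]
  · intro y hy
    exact extend_of_agree w (Finset.mem_filter.mp hy).2
  · exact fun u _ => extend_comp_wires w u x
  · intro y hy
    rw [extend_of_agree w (Finset.mem_filter.mp hy).2]

theorem applyOn_mul_apply {κ : Type*} (w : Fin m ↪ Fin q)
    (V : Matrix (Bits m × ι) (Bits m × ι) ℂ) (N : Matrix (Bits q × ι) κ ℂ) (x : Bits q) (s : ι)
    (t : κ) :
    (applyOn w V * N) (x, s) t =
      ∑ u : Bits m, ∑ r, V (x ∘ w, s) (u, r) * N (Function.extend w u x, r) t := by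
  rw [Matrix.mul_apply, Fintype.sum_prod_type]
  have h := sum_agree w x fun y => ∑ r, V (x ∘ w, s) (y ∘ w, r) * N (y, r) t
  simp only [extend_comp_wires] at h
  rw [← h]
  refine Finset.sum_congr rfl fun y _ => ?_
  by_cases hy : ∀ i, (∀ j, w j ≠ i) → x i = y i
  · rw [if_pos hy]
    refine Finset.sum_congr rfl fun r _ => ?_
    simp only [applyOn, Matrix.of_apply]
    rw [if_pos hy]
  · rw [if_neg hy]
    refine Finset.sum_eq_zero fun r _ => ?_
    simp only [applyOn, Matrix.of_apply]
    rw [if_neg hy, zero_mul]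

theorem agree_extend_iff (w : Fin m ↪ Fin q) (u : Bits m) (x y : Bits q) :
    (∀ i, (∀ j, w j ≠ i) → Function.extend w u x i = y i) ↔
      ∀ i, (∀ j, w j ≠ i) → x i = y i := by
  refine forall_congr' fun i => forall_congr' fun hi => ?_
  rw [Function.extend_apply' _ _ _ (by simpa using hi)]

theorem applyOn_mul (w : Fin m ↪ Fin q) (V V' : Matrix (Bits m × ι) (Bits m × ι) ℂ) :
    applyOn w V * applyOn w V' = applyOn w (V * V') := by
  ext ⟨x, s⟩ ⟨y, t⟩
  rw [applyOn_mul_apply]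
  simp only [applyOn, Matrix.of_apply, agree_extend_iff, extend_comp_wires]
  split_ifs with h
  · rw [Matrix.mul_apply, Fintype.sum_prod_type]
  · simp

theorem applyOn_one (w : Fin m ↪ Fin q) :
    applyOn w (1 : Matrix (Bits m × ι) (Bits m × ι) ℂ) = 1 := by
  ext ⟨x, s⟩ ⟨y, t⟩
  simp only [applyOn, Matrix.of_apply, Matrix.one_apply, Prod.mk.injEq]
  by_cases hxy : x = y
  · subst hxy
    simp
  · rw [if_neg (show ¬(x = y ∧ s = t) from fun h => hxy h.1)]
    by_cases h1 : ∀ i, (∀ j, w j ≠ i) → x i = y i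
    · rw [if_pos h1, if_neg]
      rintro ⟨h2, _⟩
      refine hxy ?_
      rw [← extend_of_agree w h1, ← h2]
      exact (extend_of_agree w fun _ _ => rfl).symm
    · rw [if_neg h1]

theorem applyOn_conjTranspose (w : Fin m ↪ Fin q) (V : Matrix (Bits m × ι) (Bits m × ι) ℂ) :
    (applyOn w V)ᴴ = applyOn w Vᴴ := by
  ext ⟨x, s⟩ ⟨y, t⟩
  simp only [applyOn, Matrix.of_apply, Matrix.conjTranspose_apply]
  simp only [eq_comm (a := y _)]
  split_ifs <;> simp

theorem applyOn_mem_unitaryGroup (w : Fin m ↪ Fin q) {V : Matrix (Bits m × ι) (Bits m × ι) ℂ}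
    (hV : V ∈ Matrix.unitaryGroup (Bits m × ι) ℂ) :
    applyOn w V ∈ Matrix.unitaryGroup (Bits q × ι) ℂ := by
  rw [Matrix.mem_unitaryGroup_iff, Matrix.star_eq_conjTranspose] at hV ⊢
  rw [applyOn_conjTranspose, applyOn_mul, hV, applyOn_one]

theorem controlled_apply_cons (V : Matrix (Bits k × ι) (Bits k × ι) ℂ) (b b' : Bool)
    (x y : Bits k) (s t : ι) :
    controlled V ((Fin.cons b x : Bits (k + 1)), s) ((Fin.cons b' y : Bits (k + 1)), t) =
      if b = b' then (if b = true then V else 1) (x, s) (y, t) else 0 := rfl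

theorem controlled_mul (V V' : Matrix (Bits k × ι) (Bits k × ι) ℂ) :
    controlled V * controlled V' = controlled (V * V') := by
  ext ⟨x, s⟩ ⟨y, t⟩
  refine Fin.consCases (fun b x => ?_) x
  refine Fin.consCases (fun b' y => ?_) y
  rw [Matrix.mul_apply, Fintype.sum_prod_type,
    ← (Fin.consEquiv fun _ : Fin (k + 1) => Bool).sum_comp, Fintype.sum_prod_type]
  simp only [Fin.consEquiv, Equiv.coe_fn_mk, controlled_apply_cons, Fintype.sum_bool]
  cases b <;> cases b' <;>
    simp [Matrix.mul_apply, Fintype.sum_prod_type, Matrix.one_apply, Prod.mk.injEq, ite_and]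

theorem controlled_one : controlled (1 : Matrix (Bits k × ι) (Bits k × ι) ℂ) = 1 := by
  ext ⟨x, s⟩ ⟨y, t⟩
  refine Fin.consCases (fun b x => ?_) x
  refine Fin.consCases (fun b' y => ?_) y
  rw [controlled_apply_cons, ite_self]
  simp only [Matrix.one_apply, Prod.mk.injEq, Fin.cons_inj, ← ite_and, and_assoc]

theorem controlled_conjTranspose (V : Matrix (Bits k × ι) (Bits k × ι) ℂ) :
    (controlled V)ᴴ = controlled Vᴴ := by
  ext ⟨x, s⟩ ⟨y, t⟩
  refine Fin.consCases (fun b x => ?_) x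
  refine Fin.consCases (fun b' y => ?_) y
  rw [Matrix.conjTranspose_apply, controlled_apply_cons, controlled_apply_cons]
  cases b <;> cases b' <;> simp [Matrix.one_apply, eq_comm]

theorem controlled_mem_unitaryGroup {V : Matrix (Bits k × ι) (Bits k × ι) ℂ}
    (hV : V ∈ Matrix.unitaryGroup (Bits k × ι) ℂ) :
    controlled V ∈ Matrix.unitaryGroup (Bits (k + 1) × ι) ℂ := by
  rw [Matrix.mem_unitaryGroup_iff, Matrix.star_eq_conjTranspose] at hV ⊢
  rw [controlled_conjTranspose, controlled_mul, hV, controlled_one]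

theorem Gate.eval_mem_unitaryGroup {U : Matrix (Bits k × ι) (Bits k × ι) ℂ}
    (hU : U ∈ Matrix.unitaryGroup (Bits k × ι) ℂ) (g : Gate k q) :
    g.eval U ∈ Matrix.unitaryGroup (Bits q × ι) ℂ := by
  have hU' : ∀ inv : Bool, (if inv then Uᴴ else U) ∈ Matrix.unitaryGroup (Bits k × ι) ℂ := by
    intro inv
    cases inv
    · exact hU
    · exact Unitary.star_mem hU
  cases g with
  | elementary hm w g =>
    exact applyOn_mem_unitaryGroup w (Matrix.kronecker_mem_unitary g.2 (one_mem _))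
  | query inv w => exact applyOn_mem_unitaryGroup w (hU' inv)
  | controlledQuery inv w =>
    exact applyOn_mem_unitaryGroup w (controlled_mem_unitaryGroup (hU' inv))

theorem Circuit.eval_mem_unitaryGroup {U : Matrix (Bits k × ι) (Bits k × ι) ℂ}
    (hU : U ∈ Matrix.unitaryGroup (Bits k × ι) ℂ) (c : Circuit k q) :
    c.eval U ∈ Matrix.unitaryGroup (Bits q × ι) ℂ := by
  induction c with
  | nil => exact one_mem _
  | cons g c ih => exact mul_mem ih (g.eval_mem_unitaryGroup hU)

theorem Circuit.eval_append (U : Matrix (Bits k × ι) (Bits k × ι) ℂ) (c c' : Circuit k q) :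
    Circuit.eval U (c ++ c') = Circuit.eval U c' * Circuit.eval U c := by
  induction c with
  | nil => simp [Circuit.eval]
  | cons g c ih => simp [Circuit.eval, ih, Matrix.mul_assoc]

theorem Circuit.eval_cons (U : Matrix (Bits k × ι) (Bits k × ι) ℂ) (g : Gate k q)
    (c : Circuit k q) : Circuit.eval U (g :: c) = Circuit.eval U c * g.eval U := rfl

theorem Circuit.eval_nil (U : Matrix (Bits k × ι) (Bits k × ι) ℂ) :
    Circuit.eval U ([] : Circuit k q) = 1 := rfl

end ApplyOn

/-! ### Polynomials on the unit circle -/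

section UnitCircle

open Polynomial ComplexConjugate

theorem infinite_unitCircle : {z : ℂ | ‖z‖ = 1}.Infinite := by
  have h : {z : ℂ | ‖z‖ = 1} = Metric.sphere (0 : ℂ) 1 := by
    ext z
    simp
  rw [h]
  refine (isPreconnected_sphere ?_ 0 1).infinite_of_nontrivial ⟨1, by simp, -1, by simp, ?_⟩
  · rw [Complex.rank_real_complex]
    exact Cardinal.one_lt_two
  · intro h
    have := congrArg Complex.re h
    norm_num at this

theorem Polynomial.eq_of_eval_eq_on_unitCircle {p q : ℂ[X]}
    (h : ∀ z : ℂ, ‖z‖ = 1 → p.eval z = q.eval z) : p = q :=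
  eq_of_infinite_eval_eq p q (infinite_unitCircle.mono fun z hz => h z hz)

/-- On the unit circle `(conj z)⁻¹ = z`, so the conjugate reciprocal polynomial takes the values `z
^ N * conj (g z)`. Identities that involve complex conjugates thus become polynomial identities. -/
theorem Polynomial.eval_reflect_map_conj {g : ℂ[X]} {N : ℕ} (hg : g.natDegree ≤ N) {z : ℂ}
    (hz : z ≠ 0) :
    ((g.map (starRingEnd ℂ)).reflect N).eval z = z ^ N * conj (g.eval (conj z)⁻¹) := by
  let _ : Invertible z⁻¹ := invertibleOfNonzero (inv_ne_zero hz)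
  have h := eval₂_reflect_mul_pow (RingHom.id ℂ) z⁻¹ N (g.map (starRingEnd ℂ))
    ((natDegree_map_le).trans hg)
  rw [invOf_eq_inv, inv_inv] at h
  have h2 : eval₂ (RingHom.id ℂ) z⁻¹ (g.map (starRingEnd ℂ)) = conj (g.eval (conj z)⁻¹) := by
    rw [← eval, eval_map, eval, hom_eval₂, RingHom.comp_id, map_inv₀, Complex.conj_conj]
  rw [h2, ← eval, inv_pow] at h
  rw [← h]
  field_simp

theorem inv_conj_of_norm_eq_one {z : ℂ} (hz : ‖z‖ = 1) : (conj z)⁻¹ = z := by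
  rw [← Complex.inv_eq_conj hz, inv_inv]

theorem mul_conj_of_norm_eq_one {z : ℂ} (hz : ‖z‖ = 1) : z * conj z = 1 := by
  rw [Complex.mul_conj', hz]
  simp

/-- The Fejér–Riesz theorem for strictly positive trigonometric polynomials. -/
theorem exists_norm_sq_eval_eq (d : ℕ) (g : ℂ[X]) (hg : g.natDegree ≤ 2 * d)
    (hpos : ∀ z : ℂ, ‖z‖ = 1 → ∃ r : ℝ, 0 < r ∧ g.eval z = r * z ^ d) :
    ∃ q : ℂ[X], q.natDegree ≤ d ∧
      ∀ z : ℂ, ‖z‖ = 1 → ((‖q.eval z‖ ^ 2 : ℝ) : ℂ) * z ^ d = g.eval z := by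
  induction d generalizing g with
  | zero =>
    obtain ⟨r, hr, h1⟩ := hpos 1 (by simp)
    obtain ⟨c, rfl⟩ := natDegree_eq_zero.mp (Nat.le_zero.mp hg)
    refine ⟨C ((√r : ℝ) : ℂ), by simp, fun z _ => ?_⟩
    simp only [eval_C, pow_zero, mul_one] at h1 ⊢
    rw [h1, Complex.norm_real, Real.norm_eq_abs, sq_abs, Real.sq_sqrt hr.le]
  | succ d ih =>
    -- Reality of `g z / z ^ (d + 1)` on the circle makes `g` its own conjugate reciprocal, so its
    -- roots come in pairs `w`, `(conj w)⁻¹`.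
    have hrefl : (g.map (starRingEnd ℂ)).reflect (2 * (d + 1)) = g := by
      refine eq_of_eval_eq_on_unitCircle fun z hz => ?_
      have hz0 : z ≠ 0 := by
        rintro rfl
        simp at hz
      obtain ⟨r, _, h⟩ := hpos z hz
      rw [eval_reflect_map_conj hg hz0, inv_conj_of_norm_eq_one hz, h, map_mul, map_pow,
        Complex.conj_ofReal]
      calc z ^ (2 * (d + 1)) * (r * conj z ^ (d + 1))
          = r * z ^ (d + 1) * (z * conj z) ^ (d + 1) := by ring
        _ = _ := by rw [mul_conj_of_norm_eq_one hz, one_pow, mul_one]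
    have htop : g.coeff (2 * (d + 1)) = conj (g.coeff 0) := by
      conv_lhs => rw [← hrefl]
      rw [coeff_reflect, coeff_map, revAt_le le_rfl, Nat.sub_self]
    by_cases h0 : g.coeff 0 = 0
    -- By symmetry the top coefficient vanishes together with the constant one, so dividing by `X`
    -- lowers the degree bound by two.
    · have hX : X * g.divX = g := by
        conv_rhs => rw [← divX_mul_X_add g, h0]
        simp [mul_comm]
      have hdeg : g.divX.natDegree ≤ 2 * d := by
        rw [natDegree_divX_eq_natDegree_tsub_one]
        have : g.natDegree ≠ 2 * (d + 1) := by
          intro h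
          rw [h0, map_zero, ← h] at htop
          have : g = 0 := leadingCoeff_eq_zero.mp htop
          simp [this] at h
        omega
      obtain ⟨q, hq, hq'⟩ := ih g.divX hdeg (by
        intro z hz
        obtain ⟨r, hr, h⟩ := hpos z hz
        refine ⟨r, hr, ?_⟩
        have hz0 : z ≠ 0 := by
          rintro rfl
          simp at hz
        rw [← hX, eval_mul, eval_X] at h
        refine mul_left_cancel₀ hz0 ?_
        rw [h]
        ring)
      refine ⟨q, by omega, fun z hz => ?_⟩
      rw [← hX, eval_mul, eval_X, ← hq' z hz]
      ring
    -- Here a root exists, is nonzero, and by positivity is off the circle; hence it differs from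
    -- its mirror image, and both linear factors can be removed.
    · have hdeg : g.natDegree = 2 * (d + 1) := by
        refine le_antisymm hg (le_natDegree_of_ne_zero ?_)
        rw [htop]
        simpa using h0
      obtain ⟨w, hw⟩ := IsAlgClosed.exists_root g (by
        intro h
        have := natDegree_eq_of_degree_eq_some (n := 0) (by simpa using h)
        omega)
      have hw0 : w ≠ 0 := by
        rintro rfl
        rw [IsRoot, ← coeff_zero_eq_eval_zero] at hw
        exact h0 hw
      have hw1 : ‖w‖ ≠ 1 := by
        intro h1
        obtain ⟨r, hr, h⟩ := hpos w h1
        rw [hw.eq_zero] at h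
        exact mul_ne_zero (Complex.ofReal_ne_zero.mpr hr.ne') (pow_ne_zero _ hw0) h.symm
      have hcw0 : conj w ≠ 0 := by simpa using hw0
      have hw' : g.eval (conj w)⁻¹ = 0 := by
        conv_lhs => rw [← hrefl]
        rw [eval_reflect_map_conj hg (inv_ne_zero hcw0)]
        simp [hw.eq_zero]
      obtain ⟨h1, rfl⟩ := dvd_iff_isRoot.mpr hw
      have hne : (conj w)⁻¹ - w ≠ 0 := by
        intro h
        have h2 : w * conj w = 1 := by
          rw [← inv_mul_cancel₀ hcw0, sub_eq_zero.mp h]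
        rw [Complex.mul_conj'] at h2
        have h3 : ‖w‖ ^ 2 = 1 := by exact_mod_cast h2
        exact hw1 ((pow_eq_one_iff_of_nonneg (norm_nonneg w) two_ne_zero).mp h3)
      have hroot : h1.IsRoot (conj w)⁻¹ := by
        rw [eval_mul, eval_sub, eval_X, eval_C] at hw'
        exact (mul_eq_zero.mp hw').resolve_left hne
      obtain ⟨h2, rfl⟩ := dvd_iff_isRoot.mpr hroot
      have h20 : h2 ≠ 0 := by
        rintro rfl
        simp at hdeg
      rw [natDegree_mul (X_sub_C_ne_zero _) (mul_ne_zero (X_sub_C_ne_zero _) h20),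
        natDegree_mul (X_sub_C_ne_zero _) h20, natDegree_X_sub_C, natDegree_X_sub_C] at hdeg
      -- On the circle `z - (conj w)⁻¹ = -(conj w)⁻¹ * z * conj (z - w)`, so the removed pair
      -- contributes the positive factor `|z - w|²`.
      have hfac : ∀ z : ℂ, ‖z‖ = 1 →
          ((X - C w) * ((X - C (conj w)⁻¹) * h2)).eval z =
            ((‖z - w‖ ^ 2 : ℝ) : ℂ) * z * (C (-(conj w)⁻¹) * h2).eval z := by
        intro z hz
        have := mul_conj_of_norm_eq_one hz
        simp only [eval_mul, eval_sub, eval_X, eval_C]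
        rw [Complex.ofReal_pow, ← Complex.mul_conj', map_sub]
        field_simp
        linear_combination ((z - w) * h2.eval z) * this
      obtain ⟨q, hq, hq'⟩ := ih (C (-(conj w)⁻¹) * h2)
        ((natDegree_C_mul_le _ _).trans (by omega)) (by
          intro z hz
          obtain ⟨r, hr, h⟩ := hpos z hz
          have hz0 : z ≠ 0 := by
            rintro rfl
            simp at hz
          have hzw : 0 < ‖z - w‖ := by
            rw [norm_pos_iff, sub_ne_zero]
            rintro rfl
            exact hw1 hz
          refine ⟨r / ‖z - w‖ ^ 2, by positivity, ?_⟩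
          rw [hfac z hz] at h
          have hzw' : ((‖z - w‖ : ℝ) : ℂ) ≠ 0 := Complex.ofReal_ne_zero.mpr hzw.ne'
          refine mul_left_cancel₀ (mul_ne_zero (pow_ne_zero 2 hzw') hz0) ?_
          rw [← Complex.ofReal_pow, h, Complex.ofReal_div]
          push_cast
          field_simp
          ring)
      refine ⟨(X - C w) * q, natDegree_mul_le.trans ?_, fun z hz => ?_⟩
      · rw [natDegree_X_sub_C]
        omega
      · rw [hfac z hz, ← hq' z hz, eval_mul, eval_sub, eval_X, eval_C, norm_mul]
        push_cast
        ring

/-! ### Pairs of polynomials produced by signal processing. -/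

/-- `Reachable d A B` says that, starting from `|0⟩`, a rotation of the signal qubit followed by
`d` rounds of the controlled signal `|0⟩⟨0| + |1⟩⟨1| X` and a rotation gives `A |0⟩ + B |1⟩`. -/
inductive Reachable : ℕ → ℂ[X] → ℂ[X] → Prop
  | base (a b : ℂ) (h : ‖a‖ ^ 2 + ‖b‖ ^ 2 = 1) : Reachable 0 (C a) (C b)
  | step (a b : ℂ) (h : ‖a‖ ^ 2 + ‖b‖ ^ 2 = 1) {d : ℕ} {A B : ℂ[X]} (hAB : Reachable d A B) :
      Reachable (d + 1) (C a * A - C (conj b) * (X * B)) (C b * A + C (conj a) * (X * B))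

/-- Normalise `(p, q)` if it is nonzero. Otherwise the middle condition is void, and any unit vector
orthogonal to `(p', q')` will do. -/
theorem exists_unit_vector (p q p' q' : ℂ) (h : p * conj p' + q * conj q' = 0) :
    ∃ a b : ℂ, ‖a‖ ^ 2 + ‖b‖ ^ 2 = 1 ∧ a * q = b * p ∧ conj a * p' + conj b * q' = 0 := by
  have key : ∀ u v : ℂ, ¬ (u = 0 ∧ v = 0) → ∃ r : ℝ, r ≠ 0 ∧
      ‖(r : ℂ) * u‖ ^ 2 + ‖(r : ℂ) * v‖ ^ 2 = 1 := by
    intro u v huv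
    have hpos : 0 < ‖u‖ ^ 2 + ‖v‖ ^ 2 := by
      by_cases hu : u = 0
      · have hv : v ≠ 0 := fun hv => huv ⟨hu, hv⟩
        have := norm_pos_iff.mpr hv
        positivity
      · have := norm_pos_iff.mpr hu
        positivity
    refine ⟨(√(‖u‖ ^ 2 + ‖v‖ ^ 2))⁻¹, inv_ne_zero (Real.sqrt_pos.mpr hpos).ne', ?_⟩
    rw [norm_mul, norm_mul, Complex.norm_real, Real.norm_eq_abs, mul_pow, mul_pow, sq_abs,
      inv_pow, Real.sq_sqrt hpos.le, ← mul_add, inv_mul_cancel₀ hpos.ne']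
  by_cases h1 : p = 0 ∧ q = 0
  · by_cases h2 : p' = 0 ∧ q' = 0
    · exact ⟨1, 0, by simp, by simp [h1.2], by simp [h2.1]⟩
    · obtain ⟨r, _, hr⟩ := key (-conj q') (conj p') (by simpa [and_comm] using h2)
      refine ⟨r * (-conj q'), r * conj p', hr, by simp [h1.1, h1.2], ?_⟩
      simp only [map_mul, map_neg, Complex.conj_conj, Complex.conj_ofReal]
      ring
  · obtain ⟨r, _, hr⟩ := key p q h1
    refine ⟨r * p, r * q, hr, by ring, ?_⟩
    have h' := congrArg conj h
    simp only [map_add, map_mul, Complex.conj_conj, map_zero] at h'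
    simp only [map_mul, Complex.conj_ofReal]
    linear_combination (r : ℂ) * h'

/-- One layer is peeled off at a time: a suitable inverse rotation makes the second component
divisible by `X` and at the same time lowers the degree of the first. -/
theorem reachable_of_norm_sq_add_norm_sq (d : ℕ) (P Q : ℂ[X]) (hP : P.natDegree ≤ d)
    (hQ : Q.natDegree ≤ d)
    (h : ∀ z : ℂ, ‖z‖ = 1 → ‖P.eval z‖ ^ 2 + ‖Q.eval z‖ ^ 2 = 1) : Reachable d P Q := by
  induction d generalizing P Q with
  | zero =>
    obtain ⟨a, rfl⟩ := natDegree_eq_zero.mp (Nat.le_zero.mp hP)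
    obtain ⟨b, rfl⟩ := natDegree_eq_zero.mp (Nat.le_zero.mp hQ)
    exact Reachable.base a b (by simpa using h 1 (by simp))
  | succ d ih =>
    have hpoly : P * (P.map (starRingEnd ℂ)).reflect (d + 1) +
        Q * (Q.map (starRingEnd ℂ)).reflect (d + 1) = X ^ (d + 1) := by
      refine eq_of_eval_eq_on_unitCircle fun z hz => ?_
      have hz0 : z ≠ 0 := by
        rintro rfl
        simp at hz
      rw [eval_add, eval_mul, eval_mul, eval_reflect_map_conj hP hz0,
        eval_reflect_map_conj hQ hz0, inv_conj_of_norm_eq_one hz, eval_pow, eval_X]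
      have h' : P.eval z * conj (P.eval z) + Q.eval z * conj (Q.eval z) = 1 := by
        rw [Complex.mul_conj', Complex.mul_conj']
        exact_mod_cast h z hz
      linear_combination z ^ (d + 1) * h'
    -- The constant coefficient of `hpoly` says that the vectors of lowest and of highest
    -- coefficients are orthogonal, so one rotation annihilates both unwanted coefficients.
    have horth : P.coeff 0 * conj (P.coeff (d + 1)) + Q.coeff 0 * conj (Q.coeff (d + 1)) = 0 := by
      have := congrArg (fun p => p.coeff 0) hpoly
      simpa [mul_coeff_zero, coeff_reflect, revAt_le] using this
    obtain ⟨a, b, hab, h1, h2⟩ := exists_unit_vector _ _ _ _ horth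
    have hab' : a * conj a + b * conj b = 1 := by
      rw [Complex.mul_conj', Complex.mul_conj']
      exact_mod_cast hab
    set A := C (conj a) * P + C (conj b) * Q with hA
    set B := (C a * Q - C b * P).divX with hB
    have hXB : X * B = C a * Q - C b * P := by
      have h0 : (C a * Q - C b * P).coeff 0 = 0 := by
        simp [h1]
      conv_rhs => rw [← divX_mul_X_add (C a * Q - C b * P), h0]
      rw [hB]
      simp [mul_comm]
    have hAB : Reachable d A B := by
      refine ih A B ?_ ?_ fun z hz => ?_
      · refine natDegree_le_iff_coeff_eq_zero.mpr fun n hn => ?_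
        rcases Nat.lt_or_ge (d + 1) n with hn' | hn'
        · rw [hA, coeff_add, coeff_C_mul, coeff_C_mul,
            coeff_eq_zero_of_natDegree_lt (hP.trans_lt hn'),
            coeff_eq_zero_of_natDegree_lt (hQ.trans_lt hn')]
          simp
        · obtain rfl : n = d + 1 := by omega
          simpa [hA] using h2
      · rw [hB, natDegree_divX_eq_natDegree_tsub_one]
        have : (C a * Q - C b * P).natDegree ≤ d + 1 := by
          simpa using natDegree_sub_le_of_le ((natDegree_C_mul_le _ _).trans hQ)
            ((natDegree_C_mul_le _ _).trans hP)
        omega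
      · have hBz : ‖B.eval z‖ = ‖a * Q.eval z - b * P.eval z‖ := by
          have := congrArg (fun p => ‖p.eval z‖) hXB
          simpa [hz] using this
        have hAz : A.eval z = conj a * P.eval z + conj b * Q.eval z := by
          simp [hA]
        rw [hBz, hAz, ← h z hz]
        have hcast : ∀ x y : ℝ, (x : ℂ) = y → x = y := fun x y h => by exact_mod_cast h
        apply hcast
        push_cast
        simp only [← Complex.mul_conj', map_add, map_sub, map_mul, Complex.conj_conj]
        linear_combination (P.eval z * conj (P.eval z) + Q.eval z * conj (Q.eval z)) * hab'
    have habC : C a * C (conj a) + C b * C (conj b) = (1 : ℂ[X]) := by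
      rw [← C_mul, ← C_mul, ← C_add, hab', C_1]
    have hPeq : P = C a * A - C (conj b) * (X * B) := by
      rw [hXB, hA]
      linear_combination (-P) * habC
    have hQeq : Q = C b * A + C (conj a) * (X * B) := by
      rw [hXB, hA]
      linear_combination (-Q) * habC
    rw [hPeq, hQeq]
    exact Reachable.step a b hab hAB

end UnitCircle

/-! ### Multiply controlled phases from one- and two-qubit gates -/

noncomputable section Gates

set_option linter.unusedSectionVars false

open ComplexConjugate

variable {ι : Type*} [Fintype ι] [DecidableEq ι] {q k : ℕ}

/-- A unitary on one qubit, as an operator on a register of length one. -/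
def liftQubit (g : Matrix.unitaryGroup Bool ℂ) : Matrix.unitaryGroup (Bits 1) ℂ :=
  ⟨(g : Matrix Bool Bool ℂ).submatrix (Equiv.funUnique (Fin 1) Bool)
      (Equiv.funUnique (Fin 1) Bool), by
    rw [Matrix.mem_unitaryGroup_iff, Matrix.star_eq_conjTranspose, Matrix.conjTranspose_submatrix,
      Matrix.submatrix_mul_equiv, ← Matrix.star_eq_conjTranspose,
      Matrix.mem_unitaryGroup_iff.mp g.2, Matrix.submatrix_one_equiv]⟩

/-- A one-qubit gate on the wire `c`. -/
def oneQubit (c : Fin q) (g : Matrix.unitaryGroup Bool ℂ) : Gate k q :=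
  .elementary (Or.inl rfl) ⟨fun _ => c, Function.injective_of_subsingleton _⟩ (liftQubit g)

theorem oneQubit_eval_mul_apply {κ : Type*} (U : Matrix (Bits k × ι) (Bits k × ι) ℂ) (c : Fin q)
    (g : Matrix.unitaryGroup Bool ℂ) (N : Matrix (Bits q × ι) κ ℂ) (x : Bits q) (s : ι) (t : κ) :
    ((oneQubit c g : Gate k q).eval U * N) (x, s) t =
      ∑ b : Bool, (g : Matrix Bool Bool ℂ) (x c) b * N (Function.update x c b, s) t := by
  rw [oneQubit, Gate.eval, applyOn_mul_apply, ← (Equiv.funUnique (Fin 1) Bool).sum_comp]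
  refine Finset.sum_congr rfl fun u _ => ?_
  rw [Finset.sum_eq_single s]
  · have hu : Function.extend (⟨fun _ => c, Function.injective_of_subsingleton _⟩ : Fin 1 ↪ Fin q)
        u x = Function.update x c (u 0) := by
      funext i
      by_cases hi : i = c
      · subst hi
        rw [Function.update_self]
        exact (Function.injective_of_subsingleton fun _ : Fin 1 => i).extend_apply u x 0
      · rw [Function.update_of_ne hi, Function.extend_apply']
        rintro ⟨_, rfl⟩
        exact hi rfl
    rw [hu]
    simp [liftQubit, Matrix.kroneckerMap_apply]
  · intro r _ hr
    simp [Matrix.kroneckerMap_apply, hr.symm]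
  · simp

/-- The operator that multiplies the basis state `|x⟩` of the wires by `φ x`. -/
def diagOp (φ : Bits q → ℂ) : Matrix (Bits q × ι) (Bits q × ι) ℂ :=
  Matrix.diagonal fun x => φ x.1

theorem diagOp_mul_apply {κ : Type*} (φ : Bits q → ℂ) (N : Matrix (Bits q × ι) κ ℂ) (x : Bits q)
    (s : ι) (t : κ) : (diagOp (ι := ι) φ * N) (x, s) t = φ x * N (x, s) t := by
  rw [diagOp, Matrix.diagonal_mul]

theorem diagOp_mul (φ φ' : Bits q → ℂ) :
    (diagOp φ * diagOp φ' : Matrix (Bits q × ι) (Bits q × ι) ℂ) = diagOp fun x => φ x * φ' x := by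
  rw [diagOp, diagOp, Matrix.diagonal_mul_diagonal, diagOp]

/-- The operator that permutes the basis states of the wires by the involution `τ`. -/
def permOp (τ : Bits q → Bits q) : Matrix (Bits q × ι) (Bits q × ι) ℂ :=
  (1 : Matrix (Bits q × ι) (Bits q × ι) ℂ).submatrix (Prod.map τ id) id

theorem permOp_mul_apply {κ : Type*} (τ : Bits q → Bits q) (N : Matrix (Bits q × ι) κ ℂ)
    (x : Bits q) (s : ι) (t : κ) : (permOp (ι := ι) τ * N) (x, s) t = N (τ x, s) t := by
  rw [permOp, Matrix.mul_apply]
  simp [Matrix.one_apply]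

theorem permOp_mul_diagOp_mul_permOp (τ : Bits q → Bits q) (hτ : ∀ x, τ (τ x) = x)
    (φ : Bits q → ℂ) :
    (permOp τ * (diagOp φ * permOp τ) : Matrix (Bits q × ι) (Bits q × ι) ℂ) =
      diagOp fun x => φ (τ x) := by
  ext ⟨x, s⟩ t
  rw [permOp_mul_apply, diagOp_mul_apply, permOp, Matrix.submatrix_apply, Prod.map_apply, hτ,
    diagOp, Matrix.diagonal_apply, Matrix.one_apply]
  simp

/-- A diagonal two-qubit gate on the wires `a` and `b` (nothing if they coincide). -/
def phaseGate (a b : Fin q) (d : Bool → Bool → ℂ) (hd : ∀ i j, ‖d i j‖ = 1) : Circuit k q :=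
  if h : a ≠ b then
    [.elementary (Or.inr rfl) ⟨![a, b], by
        intro i j hij
        fin_cases i <;> fin_cases j <;> simp_all [eq_comm]⟩
      ⟨Matrix.diagonal fun u => d (u 0) (u 1), by
        rw [Matrix.mem_unitaryGroup_iff, Matrix.star_eq_conjTranspose,
          Matrix.diagonal_conjTranspose, Matrix.diagonal_mul_diagonal, ← Matrix.diagonal_one]
        congr 1
        funext u
        exact mul_conj_of_norm_eq_one (hd _ _)⟩]
  else []

theorem phaseGate_eval (U : Matrix (Bits k × ι) (Bits k × ι) ℂ) {a b : Fin q} (h : a ≠ b)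
    (d : Bool → Bool → ℂ) (hd : ∀ i j, ‖d i j‖ = 1) :
    Circuit.eval U (phaseGate a b d hd : Circuit k q) = diagOp fun x => d (x a) (x b) := by
  rw [phaseGate, dif_pos h, Circuit.eval_cons, Circuit.eval_nil, Matrix.one_mul, Gate.eval]
  ext ⟨x, s⟩ ⟨y, t⟩
  simp only [applyOn, Matrix.of_apply, Matrix.kroneckerMap_apply, diagOp, Matrix.diagonal_apply,
    Matrix.one_apply, Prod.mk.injEq]
  by_cases hxy : x = y
  · subst hxy
    simp only [implies_true, if_true, true_and, mul_ite, mul_one, mul_zero]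
    rfl
  · rw [if_neg (show ¬(x = y ∧ s = t) from fun h => hxy h.1)]
    split_ifs with h1 h2
    · exact absurd ((extend_of_agree _ h1).symm.trans
        (h2 ▸ extend_of_agree _ fun _ _ => rfl)) (Ne.symm hxy)
    all_goals simp

theorem phaseGate_length_le (a b : Fin q) (d : Bool → Bool → ℂ) (hd : ∀ i j, ‖d i j‖ = 1) :
    (phaseGate a b d hd : Circuit k q).length ≤ 1 := by
  rw [phaseGate]
  split_ifs <;> simp

theorem phaseGate_queryCount (a b : Fin q) (d : Bool → Bool → ℂ) (hd : ∀ i j, ‖d i j‖ = 1) :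
    Circuit.queryCount (phaseGate a b d hd : Circuit k q) = 0 := by
  rw [phaseGate]
  split_ifs <;> simp [Circuit.queryCount, Gate.isQuery]

/-- The Hadamard gate. -/
def hadamard : Matrix.unitaryGroup Bool ℂ :=
  ⟨Matrix.of fun a b => ((√2)⁻¹ : ℝ) * (if (a && b) = true then -1 else 1), by
    have h : (((√2)⁻¹ : ℝ) : ℂ) * ((√2)⁻¹ : ℝ) = 1 / 2 := by
      rw [← Complex.ofReal_mul, ← mul_inv, Real.mul_self_sqrt (by norm_num)]
      norm_num
    rw [Matrix.mem_unitaryGroup_iff]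
    ext a b
    rw [Matrix.mul_apply, Fintype.sum_bool]
    simp only [Matrix.star_apply, Matrix.of_apply, RCLike.star_def, map_mul, Complex.conj_ofReal]
    cases a <;> cases b <;> simp [-Complex.ofReal_inv] <;> linear_combination 2 * h⟩

/-- The identity `H Z H = X`, controlled by a bit `α` that does not depend on the wire `c`. -/
theorem hadamard_mul_diagOp_mul_hadamard (U : Matrix (Bits k × ι) (Bits k × ι) ℂ) (c : Fin q)
    (φ : Bits q → ℂ) (α : Bits q → Bool) (hα : ∀ x b, α (Function.update x c b) = α x)
    (hφ : ∀ x, φ x = if (x c && α x) = true then -1 else 1) :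
    (oneQubit c hadamard : Gate k q).eval U *
        (diagOp φ * (oneQubit c hadamard : Gate k q).eval U) =
      permOp fun x => Function.update x c (xor (x c) (α x)) := by
  have h : (((√2)⁻¹ : ℝ) : ℂ) * ((√2)⁻¹ : ℝ) = 1 / 2 := by
    rw [← Complex.ofReal_mul, ← mul_inv, Real.mul_self_sqrt (by norm_num)]
    norm_num
  rw [← Matrix.mul_one ((oneQubit c hadamard : Gate k q).eval U), Matrix.mul_assoc,
    Matrix.one_mul, ← Matrix.mul_one (permOp _)]
  ext ⟨x, s⟩ t
  rw [oneQubit_eval_mul_apply, permOp_mul_apply]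
  simp only [diagOp_mul_apply, oneQubit_eval_mul_apply, hφ, hα, Function.update_self,
    Fintype.sum_bool, hadamard, Matrix.of_apply]
  rw [Function.update_idem, Function.update_idem, Function.update_idem, Function.update_idem]
  set M : Bool → ℂ := fun b =>
    (1 : Matrix (Bits q × ι) (Bits q × ι) ℂ) (Function.update x c b, s) t with hM
  have hM' : ∀ b, (1 : Matrix (Bits q × ι) (Bits q × ι) ℂ) (Function.update x c b, s) t = M b :=
    fun b => rfl
  simp only [hM']
  clear_value M
  cases x c <;> cases α x <;> simp [-Complex.ofReal_inv]
  · linear_combination (2 * M false) * h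
  · linear_combination (2 * M true) * h
  · linear_combination (2 * M true) * h
  · linear_combination (2 * M false) * h

theorem eval_conjugate (U : Matrix (Bits k × ι) (Bits k × ι) ℂ) (c d : Circuit k q) :
    Circuit.eval U (c ++ d ++ c) = Circuit.eval U c * (Circuit.eval U d * Circuit.eval U c) := by
  rw [Circuit.eval_append, Circuit.eval_append]

theorem eval_singleton (U : Matrix (Bits k × ι) (Bits k × ι) ℂ) (g : Gate k q) :
    Circuit.eval U [g] = g.eval U := by
  rw [Circuit.eval_cons, Circuit.eval_nil, Matrix.one_mul]

/-- The controlled-not gate with control `a` and target `b`. -/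
def cnot (a b : Fin q) : Circuit k q :=
  [oneQubit b hadamard] ++
    phaseGate a b (fun i j => if (j && i) = true then -1 else 1) (by intro i j; split_ifs <;> simp)
    ++ [oneQubit b hadamard]

theorem cnot_eval (U : Matrix (Bits k × ι) (Bits k × ι) ℂ) {a b : Fin q} (h : a ≠ b) :
    Circuit.eval U (cnot a b : Circuit k q) =
      permOp fun x => Function.update x b (xor (x b) (x a)) := by
  rw [cnot, eval_conjugate, eval_singleton, phaseGate_eval U h]
  exact hadamard_mul_diagOp_mul_hadamard U b _ (fun x => x a)
    (fun x i => Function.update_of_ne h _ _) fun x => rfl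

/-- Flips the wire `t` if the wire `c` carries `1` and the wire `x` carries `0`. -/
def toffoli (c x t : Fin q) : Circuit k q :=
  [oneQubit t hadamard] ++
    (phaseGate c t (fun i j => if (i && j) = true then Complex.I else 1)
        (by intro i j; split_ifs <;> simp) ++
      phaseGate x t (fun i j => if (!i && j) = true then Complex.I else 1)
        (by intro i j; split_ifs <;> simp) ++
      (cnot c x ++
        phaseGate x t (fun i j => if (!i && j) = true then -Complex.I else 1)
          (by intro i j; split_ifs <;> simp) ++
        cnot c x)) ++
    [oneQubit t hadamard]

/-- The action of `toffoli` on basis states. -/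
def toffoliMap (c x t : Fin q) (y : Bits q) : Bits q :=
  Function.update y t (xor (y t) (y c && !y x))

/-- Between the Hadamard gates the phase is `i` to the power `t (c + x' - (c xor x'))` with `x' = 1
- x`. Since `c + x' - (c xor x') = 2 c x'`, this is the sign `(-1) ^ (t c x')`. -/
theorem toffoli_eval (U : Matrix (Bits k × ι) (Bits k × ι) ℂ) {c x t : Fin q} (hcx : c ≠ x)
    (hct : c ≠ t) (hxt : x ≠ t) :
    Circuit.eval U (toffoli c x t : Circuit k q) = permOp (toffoliMap c x t) := by
  rw [toffoli, eval_conjugate, eval_singleton, Circuit.eval_append, eval_conjugate,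
    Circuit.eval_append, phaseGate_eval U hct, phaseGate_eval U hxt, cnot_eval U hcx,
    phaseGate_eval U hxt, permOp_mul_diagOp_mul_permOp, diagOp_mul, diagOp_mul]
  · refine hadamard_mul_diagOp_mul_hadamard U t _ (fun y => y c && !y x) ?_ ?_
    · intro y b
      simp only [Function.update_of_ne hct, Function.update_of_ne hxt]
    · intro y
      simp only [Function.update_self, Function.update_of_ne hxt.symm]
      cases y c <;> cases y x <;> cases y t <;> simp
  · intro y
    simp only [Function.update_self, Function.update_of_ne hcx, Function.update_idem]
    cases y c <;> cases h : y x <;> simp [← h]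

theorem toffoliMap_toffoliMap {c x t : Fin q} (hct : c ≠ t) (hxt : x ≠ t) (y : Bits q) :
    toffoliMap c x t (toffoliMap c x t y) = y := by
  simp only [toffoliMap, Function.update_self, Function.update_of_ne hct,
    Function.update_of_ne hxt, Function.update_idem]
  cases y c <;> cases y x <;> cases h : y t <;> simp [← h]

theorem queryCount_append (c c' : Circuit k q) :
    Circuit.queryCount (c ++ c') = c.queryCount + c'.queryCount := List.countP_append

theorem queryCount_oneQubit (c : Fin q) (g : Matrix.unitaryGroup Bool ℂ) :
    Circuit.queryCount ([oneQubit c g] : Circuit k q) = 0 := rfl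

theorem cnot_length_le (a b : Fin q) : (cnot a b : Circuit k q).length ≤ 3 := by
  rw [cnot, List.length_append, List.length_append, List.length_singleton]
  have := phaseGate_length_le (k := k) a b (fun i j => if (j && i) = true then -1 else 1)
    (by intro i j; split_ifs <;> simp)
  omega

theorem cnot_queryCount (a b : Fin q) : Circuit.queryCount (cnot a b : Circuit k q) = 0 := by
  rw [cnot, queryCount_append, queryCount_append, phaseGate_queryCount, queryCount_oneQubit]

theorem toffoli_length_le (c x t : Fin q) : (toffoli c x t : Circuit k q).length ≤ 11 := by
  simp only [toffoli, List.length_append, List.length_singleton]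
  have h1 := phaseGate_length_le (k := k) c t
    (fun i j => if (i && j) = true then Complex.I else 1) (by intro i j; split_ifs <;> simp)
  have h2 := phaseGate_length_le (k := k) x t
    (fun i j => if (!i && j) = true then Complex.I else 1) (by intro i j; split_ifs <;> simp)
  have h3 := phaseGate_length_le (k := k) x t
    (fun i j => if (!i && j) = true then -Complex.I else 1) (by intro i j; split_ifs <;> simp)
  have h4 := cnot_length_le (k := k) c x
  omega

theorem toffoli_queryCount (c x t : Fin q) :
    Circuit.queryCount (toffoli c x t : Circuit k q) = 0 := by
  simp only [toffoli, queryCount_append, phaseGate_queryCount, queryCount_oneQubit,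
    cnot_queryCount, add_zero]

/-- The Pauli `Z` gate. -/
def pauliZ : Matrix.unitaryGroup Bool ℂ :=
  ⟨Matrix.diagonal fun b => if b = true then -1 else 1, by
    rw [Matrix.mem_unitaryGroup_iff, Matrix.star_eq_conjTranspose,
      Matrix.diagonal_conjTranspose, Matrix.diagonal_mul_diagonal, ← Matrix.diagonal_one]
    congr 1
    funext b
    cases b <;> simp⟩

theorem pauliZ_eval (U : Matrix (Bits k × ι) (Bits k × ι) ℂ) (c : Fin q) :
    (oneQubit c pauliZ : Gate k q).eval U = diagOp fun x => if x c = true then -1 else 1 := by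
  rw [← Matrix.mul_one (Gate.eval _ _), ← Matrix.mul_one (diagOp _)]
  ext ⟨x, s⟩ t
  rw [oneQubit_eval_mul_apply, diagOp_mul_apply, Finset.sum_eq_single (x c)]
  · rw [Function.update_eq_self]
    simp [pauliZ]
  · intro b _ hb
    simp [pauliZ, Matrix.diagonal_apply_ne _ hb.symm]
  · simp

/-- Multiplies by `-1` the basis states with `1` on the wire `c` and `0` on the first wire of each
pair in the list, the second wires serving as clean work space. -/
def multiPhase : Fin q → List (Fin q × Fin q) → Circuit k q
  | c, [] => [oneQubit c pauliZ]
  | c, p :: l => toffoli c p.1 p.2 ++ multiPhase p.2 l ++ toffoli c p.1 p.2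

/-- The phases of `multiPhase`. -/
def multiPhaseFun : Fin q → List (Fin q × Fin q) → Bits q → ℂ
  | c, [], y => if y c = true then -1 else 1
  | c, p :: l, y => multiPhaseFun p.2 l (toffoliMap c p.1 p.2 y)

/-- The wires of `multiPhase` are distinct where this matters. -/
def WiresDistinct : Fin q → List (Fin q × Fin q) → Prop
  | _, [] => True
  | c, p :: l => c ≠ p.1 ∧ c ≠ p.2 ∧ p.1 ≠ p.2 ∧ (∀ r ∈ l, r.1 ≠ p.2 ∧ r.2 ≠ p.2) ∧
      WiresDistinct p.2 l

theorem multiPhase_eval (U : Matrix (Bits k × ι) (Bits k × ι) ℂ) (c : Fin q)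
    (l : List (Fin q × Fin q)) (h : WiresDistinct c l) :
    Circuit.eval U (multiPhase c l : Circuit k q) = diagOp (multiPhaseFun c l) := by
  induction l generalizing c with
  | nil => exact (eval_singleton U _).trans (pauliZ_eval U c)
  | cons p l ih =>
    obtain ⟨h1, h2, h3, _, h5⟩ := h
    rw [multiPhase, eval_conjugate, ih _ h5, toffoli_eval U h1 h2 h3,
      permOp_mul_diagOp_mul_permOp _ (toffoliMap_toffoliMap h2 h3)]
    rfl

/-- Each clean work wire receives the conjunction of the carried bit with the negation of the next
wire, so the final `Z` sees the conjunction of all the conditions. -/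
theorem multiPhaseFun_eq (c : Fin q) (l : List (Fin q × Fin q)) (h : WiresDistinct c l)
    (y : Bits q) (hy : ∀ p ∈ l, y p.2 = false) :
    multiPhaseFun c l y = if y c = true ∧ ∀ p ∈ l, y p.1 = false then -1 else 1 := by
  induction l generalizing c y with
  | nil => simp [multiPhaseFun]
  | cons p l ih =>
    obtain ⟨h1, h2, h3, h4, h5⟩ := h
    have hne : ∀ i, i ≠ p.2 → toffoliMap c p.1 p.2 y i = y i :=
      fun i hi => Function.update_of_ne hi _ _
    have hself : toffoliMap c p.1 p.2 y p.2 = (y c && !y p.1) := by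
      rw [toffoliMap, Function.update_self, hy p List.mem_cons_self, Bool.false_xor]
    rw [multiPhaseFun, ih _ h5 _ fun r hr => by
      rw [hne _ (h4 r hr).2, hy r (List.mem_cons_of_mem _ hr)]]
    refine if_congr ?_ rfl rfl
    rw [hself, List.forall_mem_cons, Bool.and_eq_true, Bool.not_eq_true', and_assoc]
    refine and_congr_right fun _ => and_congr_right fun _ => forall₂_congr fun r hr => ?_
    rw [hne _ (h4 r hr).1]

theorem multiPhase_length_le (c : Fin q) (l : List (Fin q × Fin q)) :
    (multiPhase c l : Circuit k q).length ≤ 22 * l.length + 1 := by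
  induction l generalizing c with
  | nil => simp [multiPhase]
  | cons p l ih =>
    have h1 := ih p.2
    have h2 := toffoli_length_le (k := k) c p.1 p.2
    simp only [multiPhase, List.length_append, List.length_cons]
    omega

theorem multiPhase_queryCount (c : Fin q) (l : List (Fin q × Fin q)) :
    Circuit.queryCount (multiPhase c l : Circuit k q) = 0 := by
  induction l generalizing c with
  | nil => exact queryCount_oneQubit c pauliZ
  | cons p l ih =>
    rw [multiPhase, queryCount_append, queryCount_append, toffoli_queryCount, ih]

end Gates

/-! ### Generalized quantum signal processing of a block encoding -/

noncomputable section SignalProcessing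

set_option linter.unusedSectionVars false

open Polynomial ComplexConjugate

variable {ι : Type*} [Fintype ι] [DecidableEq ι] {k : ℕ}

/-- The number of ancillas: a signal qubit, the ancillas of the block encoding, and as many qubits
of work space. -/
def numWires (k : ℕ) : ℕ := Fintype.card (Option (Fin k ⊕ Fin k))

/-- The roles of the wires. -/
def wire (k : ℕ) : Option (Fin k ⊕ Fin k) ≃ Fin (numWires k) := Fintype.equivFin _

/-- The wires on which the oracle acts. -/
def oracleWires (k : ℕ) : Fin k ↪ Fin (numWires k) :=
  ⟨fun i => wire k (some (Sum.inl i)), fun i j h => by simpa using h⟩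

/-- The basis state with signal qubit `b`, oracle ancillas `y` and clean work space. -/
def encode (b : Bool) (y : Bits k) : Bits (numWires k) :=
  fun j => ((wire k).symm j).elim b (Sum.elim y fun _ => false)

@[simp] theorem encode_signal (b : Bool) (y : Bits k) : encode b y (wire k none) = b := by
  simp [encode]

@[simp] theorem encode_oracle (b : Bool) (y : Bits k) (i : Fin k) :
    encode b y (wire k (some (Sum.inl i))) = y i := by
  simp [encode]

@[simp] theorem encode_work (b : Bool) (y : Bits k) (i : Fin k) :
    encode b y (wire k (some (Sum.inr i))) = false := by
  simp [encode]

theorem encode_comp_oracleWires (b : Bool) (y : Bits k) : encode b y ∘ oracleWires k = y :=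
  funext fun i => encode_oracle b y i

theorem update_encode (b b' : Bool) (y : Bits k) :
    Function.update (encode b y) (wire k none) b' = encode b' y := by
  funext j
  obtain ⟨o, rfl⟩ := (wire k).surjective j
  by_cases h : o = none
  · subst h
    simp
  · rw [Function.update_of_ne (by simpa using h)]
    obtain ⟨o, rfl⟩ := Option.ne_none_iff_exists'.mp h
    cases o <;> simp

/-- The isometry that adds the signal qubit in state `b` and clean work space. -/
def embed (ι : Type*) [DecidableEq ι] (k : ℕ) (b : Bool) :
    Matrix (Bits (numWires k) × ι) (Bits k × ι) ℂ :=
  (1 : Matrix (Bits (numWires k) × ι) (Bits (numWires k) × ι) ℂ).submatrix id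
    (Prod.map (encode b) id)

theorem embed_apply (b : Bool) (x : Bits (numWires k)) (s : ι) (y : Bits k) (t : ι) :
    embed ι k b (x, s) (y, t) = if x = encode b y ∧ s = t then 1 else 0 := by
  simp [embed, Matrix.one_apply]

theorem mul_embed_apply {κ : Type*} (N : Matrix κ (Bits (numWires k) × ι) ℂ) (b : Bool) (r : κ)
    (y : Bits k) (t : ι) : (N * embed ι k b) r (y, t) = N r (encode b y, t) := by
  rw [embed, Matrix.mul_apply]
  simp [Matrix.one_apply]

theorem agree_encode_iff (b : Bool) (x : Bits (numWires k)) (y : Bits k) :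
    (∀ i, (∀ j, oracleWires k j ≠ i) → x i = encode b y i) ↔
      x = encode b (x ∘ oracleWires k) := by
  constructor
  · intro h
    funext i
    obtain ⟨o, rfl⟩ := (wire k).surjective i
    rcases o with _ | o | o
    · simpa using h (wire k none) fun j => (wire k).injective.ne (by simp)
    · rw [encode_oracle]
      rfl
    · simpa using h (wire k (some (Sum.inr o))) fun j => (wire k).injective.ne (by simp)
  · intro h i hi
    rw [h]
    obtain ⟨o, rfl⟩ := (wire k).surjective i
    rcases o with _ | o | o
    · simp
    · exact absurd rfl (hi o)
    · simp

/-- Circuits are only evaluated on the states with clean work space. There the gates reduce to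
operators on the oracle ancillas and the system, and `embed` intertwines the two. -/
theorem applyOn_oracleWires_mul_embed (V : Matrix (Bits k × ι) (Bits k × ι) ℂ) (b : Bool) :
    applyOn (oracleWires k) V * embed ι k b = embed ι k b * V := by
  ext ⟨x, s⟩ ⟨y, t⟩
  rw [mul_embed_apply, Matrix.mul_apply]
  simp only [applyOn, Matrix.of_apply, agree_encode_iff, encode_comp_oracleWires]
  split_ifs with h
  · rw [Finset.sum_eq_single (x ∘ oracleWires k, s)]
    · rw [embed_apply, if_pos ⟨h, rfl⟩, one_mul]
    · rintro ⟨u, r⟩ _ hu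
      rw [embed_apply, if_neg, zero_mul]
      rintro ⟨rfl, rfl⟩
      exact hu (by rw [encode_comp_oracleWires])
    · simp
  · refine (Finset.sum_eq_zero fun u _ => ?_).symm
    rw [embed_apply, if_neg, zero_mul]
    rintro ⟨rfl, _⟩
    exact h (by rw [encode_comp_oracleWires])

theorem oneQubit_eval_mul_embed (U : Matrix (Bits k × ι) (Bits k × ι) ℂ)
    (g : Matrix.unitaryGroup Bool ℂ) (b : Bool) :
    (oneQubit (wire k none) g : Gate k (numWires k)).eval U * embed ι k b =
      ∑ b', (g : Matrix Bool Bool ℂ) b' b • embed ι k b' := by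
  ext ⟨x, s⟩ ⟨y, t⟩
  rw [oneQubit_eval_mul_apply, Matrix.sum_apply, Finset.sum_eq_single b,
    Finset.sum_eq_single (x (wire k none))]
  · rw [Matrix.smul_apply, embed_apply, embed_apply, smul_eq_mul]
    congr 1
    refine if_congr (and_congr_left fun _ => ?_) rfl rfl
    constructor
    · intro h
      rw [← update_encode b, ← h, Function.update_idem, Function.update_eq_self]
    · intro h
      rw [h, update_encode]
  · intro b' _ hb'
    rw [Matrix.smul_apply, embed_apply, if_neg, smul_zero]
    rintro ⟨rfl, _⟩
    exact hb' (encode_signal _ _).symm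
  · simp
  · intro b' _ hb'
    rw [embed_apply, if_neg, mul_zero]
    rintro ⟨h, _⟩
    have := congrFun h (wire k none)
    rw [Function.update_self, encode_signal] at this
    exact hb' this
  · simp

theorem diagOp_mul_embed (φ : Bits (numWires k) → ℂ) (b : Bool) :
    diagOp (ι := ι) φ * embed ι k b =
      embed ι k b * Matrix.diagonal (fun y : Bits k × ι => φ (encode b y.1)) := by
  ext ⟨x, s⟩ ⟨y, t⟩
  rw [diagOp, Matrix.diagonal_mul, Matrix.mul_diagonal, embed_apply]
  split_ifs with h
  · rw [h.1, mul_comm]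
  · simp

theorem embed_conjTranspose_mul_embed (b b' : Bool) :
    (embed ι k b)ᴴ * embed ι k b' = if b = b' then 1 else 0 := by
  ext ⟨x, s⟩ ⟨y, t⟩
  rw [mul_embed_apply, Matrix.conjTranspose_apply, embed_apply]
  by_cases hb : b = b'
  · subst hb
    rw [if_pos rfl, Matrix.one_apply, apply_ite star, star_one, star_zero]
    refine if_congr ?_ rfl rfl
    rw [Prod.mk.injEq, eq_comm (a := s)]
    refine and_congr_left fun _ => ⟨fun h => ?_, fun h => by rw [h]⟩
    rw [← encode_comp_oracleWires b x, ← h, encode_comp_oracleWires]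
  · rw [if_neg hb, if_neg, star_zero, Matrix.zero_apply]
    rintro ⟨h, _⟩
    have := congrFun h (wire k none)
    rw [encode_signal, encode_signal] at this
    exact hb this.symm

/-- The reflection `1 - 2 |0⟩⟨0|` on the ancillas of the block encoding. -/
def reflection (ι : Type*) [Fintype ι] [DecidableEq ι] (k : ℕ) :
    Matrix (Bits k × ι) (Bits k × ι) ℂ :=
  Matrix.diagonal fun y => if y.1 = fun _ => false then -1 else 1

/-- The wires of the oracle, each with a qubit of work space. -/
def ladder (k : ℕ) : List (Fin (numWires k) × Fin (numWires k)) :=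
  (List.finRange k).map fun i => (wire k (some (Sum.inl i)), wire k (some (Sum.inr i)))

theorem wiresDistinct_ladder (k : ℕ) : WiresDistinct (wire k none) (ladder k) := by
  have key : ∀ (l : List (Fin k)) (c : Option (Fin k ⊕ Fin k)), l.Nodup →
      (∀ i ∈ l, c ≠ some (Sum.inl i) ∧ c ≠ some (Sum.inr i)) →
      WiresDistinct (wire k c)
        (l.map fun i => (wire k (some (Sum.inl i)), wire k (some (Sum.inr i)))) := by
    intro l
    induction l with
    | nil => exact fun _ _ _ => trivial
    | cons i l ih =>
      intro c hl hc
      rw [List.nodup_cons] at hl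
      have hi : ∀ j ∈ l, j ≠ i := fun j hj h => hl.1 (h ▸ hj)
      refine ⟨?_, ?_, ?_, ?_, ?_⟩
      · simpa using (hc i List.mem_cons_self).1
      · simpa using (hc i List.mem_cons_self).2
      · simp
      · intro r hr
        obtain ⟨j, hj, rfl⟩ := List.mem_map.mp hr
        simpa using hi j hj
      · refine ih (some (Sum.inr i)) hl.2 fun j hj => ⟨by simp, ?_⟩
        simpa using (hi j hj).symm
  exact key _ _ (List.nodup_finRange k) (by simp)

/-- The reflection on the oracle ancillas, controlled by the signal qubit. -/
def controlledReflection (k : ℕ) : Circuit k (numWires k) := multiPhase (wire k none) (ladder k)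

theorem controlledReflection_eval_mul_embed (U : Matrix (Bits k × ι) (Bits k × ι) ℂ) (b : Bool) :
    Circuit.eval U (controlledReflection k) * embed ι k b =
      embed ι k b * if b = true then reflection ι k else 1 := by
  rw [controlledReflection, multiPhase_eval U _ _ (wiresDistinct_ladder k), diagOp_mul_embed]
  congr 1
  have h : ∀ y : Bits k, multiPhaseFun (wire k none) (ladder k) (encode b y) =
      if b = true ∧ y = (fun _ => false) then -1 else 1 := by
    intro y
    rw [multiPhaseFun_eq _ _ (wiresDistinct_ladder k)]
    · refine if_congr ?_ rfl rfl
      simp [ladder, funext_iff]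
    · simp [ladder]
  simp only [h]
  cases b
  · simp
  · simp [reflection]

theorem controlledReflection_length_le (k : ℕ) :
    (controlledReflection k).length ≤ 22 * k + 1 := by
  have := multiPhase_length_le (k := k) (wire k none) (ladder k)
  rwa [ladder, List.length_map, List.length_finRange] at this

/-- The walk operator `R Uᴴ R U` controlled by the signal qubit. -/
def controlledWalk (k : ℕ) : Circuit k (numWires k) :=
  .query false (oracleWires k) ::
    (controlledReflection k ++ .query true (oracleWires k) :: controlledReflection k)

/-- The inverse of the walk operator, controlled by the signal qubit. -/
def controlledWalkInv (k : ℕ) : Circuit k (numWires k) :=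
  controlledReflection k ++
    .query false (oracleWires k) ::
      (controlledReflection k ++ [.query true (oracleWires k)])

/-- The walk operator of a block encoding. -/
def walk (U : Matrix (Bits k × ι) (Bits k × ι) ℂ) : Matrix (Bits k × ι) (Bits k × ι) ℂ :=
  reflection ι k * (Uᴴ * (reflection ι k * U))

/-- The inverse of the walk operator of a block encoding. -/
def walkInv (U : Matrix (Bits k × ι) (Bits k × ι) ℂ) : Matrix (Bits k × ι) (Bits k × ι) ℂ :=
  Uᴴ * (reflection ι k * (U * reflection ι k))

theorem reflection_mul_reflection : reflection ι k * reflection ι k = 1 := by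
  rw [reflection, Matrix.diagonal_mul_diagonal, ← Matrix.diagonal_one]
  congr 1
  funext y
  split_ifs <;> norm_num

theorem query_eval_mul_embed (U : Matrix (Bits k × ι) (Bits k × ι) ℂ) (inv b : Bool) :
    (Gate.query inv (oracleWires k) : Gate k (numWires k)).eval U * embed ι k b =
      embed ι k b * if inv = true then Uᴴ else U :=
  applyOn_oracleWires_mul_embed _ b

theorem intertwine_mul {m n : Type*} [Fintype m] [Fintype n] {A B : Matrix m m ℂ}
    {E : Matrix m n ℂ} {a b : Matrix n n ℂ} (hB : B * E = E * b) (hA : A * E = E * a) :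
    B * A * E = E * (b * a) := by
  rw [Matrix.mul_assoc, hA, ← Matrix.mul_assoc, hB, Matrix.mul_assoc]

theorem walk_mul_walkInv {U : Matrix (Bits k × ι) (Bits k × ι) ℂ}
    (hU : U ∈ Matrix.unitaryGroup (Bits k × ι) ℂ) : walk U * walkInv U = 1 := by
  have h1 : U * Uᴴ = 1 := Matrix.mem_unitaryGroup_iff.mp hU
  have h2 : Uᴴ * U = 1 := Matrix.mem_unitaryGroup_iff'.mp hU
  have h3 := reflection_mul_reflection (ι := ι) (k := k)
  rw [walk, walkInv]
  calc _ = reflection ι k * (Uᴴ * (reflection ι k * ((U * Uᴴ) * reflection ι k) *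
        (U * reflection ι k))) := by simp only [Matrix.mul_assoc]
    _ = reflection ι k * ((Uᴴ * U) * reflection ι k) := by
      rw [h1, Matrix.one_mul, h3, Matrix.one_mul, Matrix.mul_assoc]
    _ = 1 := by rw [h2, Matrix.one_mul, h3]

theorem walkInv_mul_walk {U : Matrix (Bits k × ι) (Bits k × ι) ℂ}
    (hU : U ∈ Matrix.unitaryGroup (Bits k × ι) ℂ) : walkInv U * walk U = 1 :=
  mul_eq_one_comm.mp (walk_mul_walkInv hU)

/-- Only the reflections need a control: when they are switched off, the two queries cancel by `Uᴴ *
U = 1`. -/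
theorem controlledWalk_eval_mul_embed {U : Matrix (Bits k × ι) (Bits k × ι) ℂ}
    (hU : U ∈ Matrix.unitaryGroup (Bits k × ι) ℂ) (b : Bool) :
    Circuit.eval U (controlledWalk k) * embed ι k b =
      embed ι k b * if b = true then walk U else 1 := by
  have h : Circuit.eval U (controlledWalk k) * embed ι k b = embed ι k b *
      ((if b = true then reflection ι k else 1) * Uᴴ *
        (if b = true then reflection ι k else 1) * U) := by
    rw [controlledWalk, Circuit.eval_cons, Circuit.eval_append, Circuit.eval_cons]
    have hR := controlledReflection_eval_mul_embed U b
    exact intertwine_mul (intertwine_mul (intertwine_mul hR (query_eval_mul_embed U true b)) hR)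
      (query_eval_mul_embed U false b)
  rw [h]
  cases b
  · have h2 : Uᴴ * U = 1 := Matrix.mem_unitaryGroup_iff'.mp hU
    simp [h2]
  · simp [walk, Matrix.mul_assoc]

theorem controlledWalkInv_eval_mul_embed_true (U : Matrix (Bits k × ι) (Bits k × ι) ℂ) :
    Circuit.eval U (controlledWalkInv k) * embed ι k true = embed ι k true * walkInv U := by
  have h : Circuit.eval U (controlledWalkInv k) * embed ι k true = embed ι k true *
      (Uᴴ * reflection ι k * U * reflection ι k) := by
    rw [controlledWalkInv, Circuit.eval_append, Circuit.eval_cons, Circuit.eval_append,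
      eval_singleton]
    have hR := controlledReflection_eval_mul_embed U true
    exact intertwine_mul (intertwine_mul (intertwine_mul (query_eval_mul_embed U true true) hR)
      (query_eval_mul_embed U false true)) hR
  rw [h, walkInv]
  simp only [Matrix.mul_assoc]

theorem controlledWalk_queryCount (k : ℕ) : (controlledWalk k).queryCount = 2 := by
  have h : Circuit.queryCount (controlledReflection k) = 0 := multiPhase_queryCount _ _
  rw [Circuit.queryCount] at h ⊢
  simp [controlledWalk, List.countP_cons, List.countP_append, h, Gate.isQuery]

theorem controlledWalkInv_queryCount (k : ℕ) : (controlledWalkInv k).queryCount = 2 := by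
  have h : Circuit.queryCount (controlledReflection k) = 0 := multiPhase_queryCount _ _
  rw [Circuit.queryCount] at h ⊢
  simp [controlledWalkInv, List.countP_cons, List.countP_append, h, Gate.isQuery]

theorem controlledWalk_length_le (k : ℕ) : (controlledWalk k).length ≤ 44 * k + 4 := by
  have := controlledReflection_length_le k
  simp only [controlledWalk, List.length_cons, List.length_append]
  omega

theorem controlledWalkInv_length_le (k : ℕ) : (controlledWalkInv k).length ≤ 44 * k + 4 := by
  have := controlledReflection_length_le k
  simp only [controlledWalkInv, List.length_cons, List.length_append, List.length_nil]
  omega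

end SignalProcessing

/-! ### From polynomials on the circle to circuits for polynomials of `2 H² - 1`. -/

noncomputable section BlockEncodedPolynomials

set_option linter.unusedSectionVars false

open Polynomial ComplexConjugate

universe u

variable {ι : Type*} [Fintype ι] [DecidableEq ι] {k : ℕ}

/-- The rotation of a qubit with first column `(a, b)`. -/
def signalRotation (a b : ℂ) (h : ‖a‖ ^ 2 + ‖b‖ ^ 2 = 1) : Matrix.unitaryGroup Bool ℂ :=
  ⟨Matrix.of fun r c => bif c then (bif r then conj a else -conj b) else (bif r then b else a), by
    have h' : a * conj a + b * conj b = 1 := by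
      rw [Complex.mul_conj', Complex.mul_conj']
      exact_mod_cast h
    rw [Matrix.mem_unitaryGroup_iff]
    ext r c
    rw [Matrix.mul_apply, Fintype.sum_bool]
    simp only [Matrix.star_apply, Matrix.of_apply, RCLike.star_def]
    cases r <;> cases c <;> simp
    · linear_combination h'
    · ring
    · ring
    · linear_combination h'⟩

theorem signalRotation_eval_mul_embed_false (U : Matrix (Bits k × ι) (Bits k × ι) ℂ) (a b : ℂ)
    (h : ‖a‖ ^ 2 + ‖b‖ ^ 2 = 1) :
    (oneQubit (wire k none) (signalRotation a b h) : Gate k (numWires k)).eval U * embed ι k false =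
      a • embed ι k false + b • embed ι k true := by
  rw [oneQubit_eval_mul_embed, Fintype.sum_bool, add_comm]
  rfl

theorem signalRotation_eval_mul_embed_true (U : Matrix (Bits k × ι) (Bits k × ι) ℂ) (a b : ℂ)
    (h : ‖a‖ ^ 2 + ‖b‖ ^ 2 = 1) :
    (oneQubit (wire k none) (signalRotation a b h) : Gate k (numWires k)).eval U * embed ι k true =
      -conj b • embed ι k false + conj a • embed ι k true := by
  rw [oneQubit_eval_mul_embed, Fintype.sum_bool, add_comm]
  rfl

/-- `Reachable.step` is exactly the effect of a controlled walk followed by `signalRotation a b`,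
with the walk operator substituted for `X`. -/
theorem exists_circuit_of_reachable (k : ℕ) {n : ℕ} {A B : ℂ[X]} (h : Reachable n A B) :
    ∃ c : Circuit k (numWires k), c.queryCount = 2 * n ∧ c.length ≤ n * (44 * k + 5) + 1 ∧
      ∀ (ι : Type*) [Fintype ι] [DecidableEq ι] (U : Matrix (Bits k × ι) (Bits k × ι) ℂ),
        U ∈ Matrix.unitaryGroup (Bits k × ι) ℂ →
        Circuit.eval U c * embed ι k false =
          embed ι k false * aeval (walk U) A + embed ι k true * aeval (walk U) B := by
  induction h with
  | base a b h =>
    refine ⟨[oneQubit (wire k none) (signalRotation a b h)], rfl, by simp, ?_⟩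
    intro ι _ _ U hU
    rw [eval_singleton, signalRotation_eval_mul_embed_false, aeval_C, aeval_C,
      Algebra.algebraMap_eq_smul_one, Algebra.algebraMap_eq_smul_one]
    simp
  | @step a b h n A B _ ih =>
    obtain ⟨c, hq, hl, hc⟩ := ih
    refine ⟨c ++ (controlledWalk k ++ [oneQubit (wire k none) (signalRotation a b h)]), ?_, ?_, ?_⟩
    · rw [queryCount_append, queryCount_append, controlledWalk_queryCount, queryCount_oneQubit, hq]
      ring
    · have := controlledWalk_length_le k
      rw [List.length_append, List.length_append, List.length_singleton]
      nlinarith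
    · intro ι _ _ U hU
      rw [Circuit.eval_append, Circuit.eval_append, eval_singleton, Matrix.mul_assoc, hc ι U hU,
        Matrix.mul_add, Matrix.mul_assoc, Matrix.mul_assoc,
        ← Matrix.mul_assoc (Circuit.eval U (controlledWalk k)),
        ← Matrix.mul_assoc (Circuit.eval U (controlledWalk k)),
        controlledWalk_eval_mul_embed hU, controlledWalk_eval_mul_embed hU,
        ← Matrix.mul_assoc, ← Matrix.mul_assoc, ← Matrix.mul_assoc, ← Matrix.mul_assoc,
        signalRotation_eval_mul_embed_false, signalRotation_eval_mul_embed_true]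
      simp only [map_add, map_sub, map_mul, aeval_C, aeval_X, Algebra.algebraMap_eq_smul_one,
        Bool.false_eq_true, if_false, if_true, Matrix.mul_one, Matrix.add_mul, Matrix.smul_mul,
        Matrix.one_mul, Matrix.mul_add, Matrix.mul_sub, Matrix.mul_smul, Matrix.mul_assoc,
        neg_smul, Matrix.neg_mul]
      abel

theorem exists_circuit_walkInv_pow (k D : ℕ) :
    ∃ c : Circuit k (numWires k), c.queryCount = 2 * D ∧ c.length ≤ D * (44 * k + 4) + 2 ∧
      ∀ (ι : Type u) [Fintype ι] [DecidableEq ι] (U : Matrix (Bits k × ι) (Bits k × ι) ℂ),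
        Circuit.eval U c * embed ι k false = embed ι k false * walkInv U ^ D := by
  have key : ∃ c : Circuit k (numWires k), c.queryCount = 2 * D ∧ c.length ≤ D * (44 * k + 4) ∧
      ∀ (ι : Type u) [Fintype ι] [DecidableEq ι] (U : Matrix (Bits k × ι) (Bits k × ι) ℂ),
        Circuit.eval U c * embed ι k true = embed ι k true * walkInv U ^ D := by
    induction D with
    | zero => exact ⟨[], rfl, by simp, fun ι _ _ U => by simp [Circuit.eval]⟩
    | succ D ih =>
      obtain ⟨c, hq, hl, hc⟩ := ih
      refine ⟨c ++ controlledWalkInv k, ?_, ?_, ?_⟩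
      · rw [queryCount_append, hq, controlledWalkInv_queryCount]
        ring
      · have := controlledWalkInv_length_le k
        rw [List.length_append]
        nlinarith
      · intro ι _ _ U
        rw [Circuit.eval_append, pow_succ', ← intertwine_mul
          (controlledWalkInv_eval_mul_embed_true U) (hc ι U)]
  obtain ⟨c, hq, hl, hc⟩ := key
  -- The inverse walk acts when the signal is `1`, so the signal is flipped before and after. The
  -- second rotation has the opposite sign, so that the returning `|1⟩` becomes `|0⟩` without a
  -- phase.
  have h₁ : ‖(0 : ℂ)‖ ^ 2 + ‖(1 : ℂ)‖ ^ 2 = 1 := by simp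
  have h₂ : ‖(0 : ℂ)‖ ^ 2 + ‖(-1 : ℂ)‖ ^ 2 = 1 := by simp
  refine ⟨[oneQubit (wire k none) (signalRotation 0 1 h₁)] ++
    (c ++ [oneQubit (wire k none) (signalRotation 0 (-1) h₂)]), ?_, ?_, ?_⟩
  · rw [queryCount_append, queryCount_append, queryCount_oneQubit, queryCount_oneQubit, hq]
    ring
  · rw [List.length_append, List.length_append, List.length_singleton, List.length_singleton]
    omega
  · intro ι _ _ U
    have e₁ := signalRotation_eval_mul_embed_false U 0 1 h₁
    have e₂ := signalRotation_eval_mul_embed_true U 0 (-1) h₂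
    rw [zero_smul, zero_add, one_smul] at e₁
    rw [map_zero, zero_smul, add_zero, map_neg, map_one, neg_neg, one_smul] at e₂
    rw [Circuit.eval_append, Circuit.eval_append, eval_singleton, eval_singleton, Matrix.mul_assoc,
      e₁, Matrix.mul_assoc, hc ι U, ← Matrix.mul_assoc, e₂]

/-- The polynomial `X ^ D * p ((X + X⁻¹) / 2)`. -/
def joukowski (D : ℕ) (p : ℂ[X]) : ℂ[X] :=
  ∑ i ∈ Finset.range (D + 1), C (p.coeff i) * ((C (1 / 2) * (X ^ 2 + 1)) ^ i * X ^ (D - i))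

theorem joukowski_natDegree_le (D : ℕ) (p : ℂ[X]) : (joukowski D p).natDegree ≤ 2 * D := by
  refine natDegree_sum_le_of_forall_le _ _ fun i hi => ?_
  have hi' : i ≤ D := Nat.lt_succ_iff.mp (Finset.mem_range.mp hi)
  have h1 : (C (1 / 2 : ℂ) * (X ^ 2 + 1)).natDegree ≤ 2 := by compute_degree
  calc _ ≤ ((C (1 / 2 : ℂ) * (X ^ 2 + 1)) ^ i * X ^ (D - i)).natDegree := natDegree_C_mul_le _ _
    _ ≤ i * 2 + (D - i) := natDegree_mul_le.trans
        (add_le_add (natDegree_pow_le.trans (Nat.mul_le_mul_left i h1)) (natDegree_X_pow_le _))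
    _ ≤ 2 * D := by omega

/-- Stated in an arbitrary algebra because it is used twice: for a number on the circle with its
conjugate, and for the walk operator with its inverse. -/
theorem aeval_joukowski {R : Type*} [Ring R] [Algebra ℂ R] {D : ℕ} {p : ℂ[X]}
    (hp : p.natDegree ≤ D) {z w : R} (h1 : z * w = 1) (h2 : w * z = 1) :
    aeval z (joukowski D p) * w ^ D = aeval ((1 / 2 : ℂ) • (z + w)) p := by
  have hzw : Commute z w := h1.trans h2.symm
  rw [joukowski, map_sum, Finset.sum_mul, aeval_eq_sum_range' (Nat.lt_succ_of_le hp)]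
  refine Finset.sum_congr rfl fun i hi => ?_
  have hi' : i ≤ D := Nat.lt_succ_iff.mp (Finset.mem_range.mp hi)
  simp only [map_mul, map_pow, map_add, aeval_C, aeval_X, map_one]
  have h3 : z ^ (D - i) * w ^ D = w ^ i := by
    rw [← Nat.sub_add_cancel hi', pow_add w, ← mul_assoc, Nat.add_sub_cancel, ← hzw.mul_pow, h1,
      one_pow, one_mul]
  have h4 : (1 / 2 : ℂ) • (z + w) = algebraMap ℂ R (1 / 2) * (z ^ 2 + 1) * w := by
    rw [mul_assoc, ← Algebra.smul_def, add_mul, one_mul, pow_two, mul_assoc, h1, mul_one]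
  have h5 : Commute (algebraMap ℂ R (1 / 2) * (z ^ 2 + 1)) w :=
    (Algebra.commute_algebraMap_left _ _).mul_left
      ((hzw.pow_left 2).add_left (Commute.one_left w))
  rw [h4, h5.mul_pow, mul_assoc, mul_assoc, h3, Algebra.smul_def]

/-- The isometry that adds the oracle ancillas in the state `0`. -/
def ancillaZero (ι : Type*) [DecidableEq ι] (k : ℕ) : Matrix (Bits k × ι) ι ℂ :=
  (1 : Matrix (Bits k × ι) (Bits k × ι) ℂ).submatrix id fun t => (fun _ => false, t)

theorem mul_ancillaZero_apply {κ : Type*} (N : Matrix κ (Bits k × ι) ℂ) (r : κ) (t : ι) :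
    (N * ancillaZero ι k) r t = N r (fun _ => false, t) := by
  rw [ancillaZero, Matrix.mul_apply]
  simp [Matrix.one_apply]

theorem conjTranspose_ancillaZero_mul_apply {κ : Type*} (N : Matrix (Bits k × ι) κ ℂ) (r : κ)
    (t : ι) : ((ancillaZero ι k)ᴴ * N) t r = N (fun _ => false, t) r := by
  rw [ancillaZero, Matrix.mul_apply]
  simp [Matrix.one_apply]

theorem conjTranspose_ancillaZero_mul_ancillaZero :
    (ancillaZero ι k)ᴴ * ancillaZero ι k = 1 := by
  ext s t
  rw [mul_ancillaZero_apply]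
  simp [ancillaZero, Matrix.one_apply, eq_comm]

theorem isBlockEncoding_iff {U : Matrix (Bits k × ι) (Bits k × ι) ℂ} {A : Matrix ι ι ℂ} :
    IsBlockEncoding U A ↔ U ∈ Matrix.unitaryGroup (Bits k × ι) ℂ ∧
      A = (ancillaZero ι k)ᴴ * (U * ancillaZero ι k) := by
  refine and_congr_right fun _ => ?_
  have h : (Matrix.of fun s t => U (fun _ => false, s) (fun _ => false, t)) =
      (ancillaZero ι k)ᴴ * (U * ancillaZero ι k) := by
    ext s t
    rw [conjTranspose_ancillaZero_mul_apply, mul_ancillaZero_apply]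
    rfl
  rw [h]

theorem reflection_eq :
    reflection ι k = 1 - (2 : ℂ) • (ancillaZero ι k * (ancillaZero ι k)ᴴ) := by
  ext ⟨x, s⟩ ⟨y, t⟩
  rw [Matrix.sub_apply, Matrix.smul_apply, Matrix.mul_apply]
  simp only [reflection, Matrix.diagonal_apply, Matrix.one_apply, ancillaZero,
    Matrix.submatrix_apply, Matrix.conjTranspose_apply, Prod.mk.injEq, id]
  by_cases hx : x = fun _ => false
  · subst hx
    by_cases hy : y = fun _ => false
    · subst hy
      by_cases hst : s = t
      · subst hst
        simp
        norm_num
      · simp [hst]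
    · simp [hy, Ne.symm hy]
  · simp [hx]

/-- Write `W = Uᴴ R U` and let `F` be the ancilla isometry. Then `R F = -F` gives `R W F + W R F =
-2 F (Fᴴ W F)`, and hermiticity of `H` gives `Fᴴ W F = 1 - 2 H²`. -/
theorem walk_add_walkInv_mul_ancillaZero {U : Matrix (Bits k × ι) (Bits k × ι) ℂ}
    {H : Matrix ι ι ℂ} (hH : H.IsHermitian) (hU : IsBlockEncoding U H) :
    ((1 / 2 : ℂ) • (walk U + walkInv U)) * ancillaZero ι k =
      ancillaZero ι k * ((2 : ℂ) • (H * H) - 1) := by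
  obtain ⟨hU1, hU2⟩ := isBlockEncoding_iff.mp hU
  have hUU : Uᴴ * U = 1 := Matrix.mem_unitaryGroup_iff'.mp hU1
  set F := ancillaZero ι k with hF
  have hFF : Fᴴ * F = 1 := conjTranspose_ancillaZero_mul_ancillaZero
  have hU3 : H = Fᴴ * (Uᴴ * F) := by
    conv_lhs => rw [← hH.eq, hU2]
    simp only [Matrix.conjTranspose_mul, Matrix.conjTranspose_conjTranspose, Matrix.mul_assoc]
  have hRF : reflection ι k * F = -F := by
    rw [reflection_eq, Matrix.sub_mul, Matrix.one_mul, Matrix.smul_mul, Matrix.mul_assoc, hFF,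
      Matrix.mul_one]
    module
  set W := Uᴴ * (reflection ι k * U) with hW
  have hFWF : Fᴴ * (W * F) = 1 - (2 : ℂ) • (H * H) := by
    have : Fᴴ * (W * F) = Fᴴ * ((Uᴴ * U) * F) -
        (2 : ℂ) • ((Fᴴ * (Uᴴ * F)) * (Fᴴ * (U * F))) := by
      rw [hW, reflection_eq]
      simp only [Matrix.sub_mul, Matrix.mul_sub, Matrix.one_mul, Matrix.smul_mul, Matrix.mul_smul,
        Matrix.mul_assoc, ← hF]
    rw [this, hUU, Matrix.one_mul, hFF, ← hU3, ← hU2]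
  have h1 : walk U * F = W * F - (2 : ℂ) • (F * (Fᴴ * (W * F))) := by
    rw [walk, ← hW, reflection_eq, ← hF]
    simp only [Matrix.sub_mul, Matrix.one_mul, Matrix.smul_mul, Matrix.mul_assoc]
  have h2 : walkInv U * F = -(W * F) := by
    have : walkInv U * F = W * (reflection ι k * F) := by
      rw [walkInv, hW]
      simp only [Matrix.mul_assoc]
    rw [this, hRF, Matrix.mul_neg]
  rw [Matrix.smul_mul, Matrix.add_mul, h1, h2, hFWF]
  simp only [Matrix.mul_sub, Matrix.mul_one, Matrix.mul_smul]
  module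

theorem aeval_mul_eq_mul_aeval {m n : Type*} [Fintype m] [Fintype n] [DecidableEq m]
    [DecidableEq n] {A : Matrix m m ℂ} {B : Matrix n n ℂ} {F : Matrix m n ℂ}
    (h : A * F = F * B) (p : ℂ[X]) : aeval A p * F = F * aeval B p := by
  induction p using Polynomial.induction_on' with
  | add p q hp hq => rw [map_add, map_add, Matrix.add_mul, Matrix.mul_add, hp, hq]
  | monomial n r =>
    have hpow : ∀ n : ℕ, A ^ n * F = F * B ^ n := by
      intro n
      induction n with
      | zero => simp
      | succ n ih => rw [pow_succ, pow_succ, intertwine_mul ih h]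
    simp only [aeval_monomial, Algebra.algebraMap_eq_smul_one, Matrix.smul_mul, Matrix.one_mul,
      hpow, Matrix.mul_smul]

theorem embed_false_mul_ancillaZero :
    embed ι k false * ancillaZero ι k = ancillaZero ι (numWires k) := by
  ext ⟨x, s⟩ t
  rw [mul_ancillaZero_apply, embed_apply]
  have h : encode false (fun _ => false : Bits k) = fun _ => false := by
    funext j
    rw [encode]
    rcases (wire k).symm j with _ | o | o <;> rfl
  simp [h, ancillaZero, Matrix.one_apply]

theorem joukowski_eval {D : ℕ} {p : ℝ[X]} (hp : p.natDegree ≤ D) {z : ℂ} (hz : ‖z‖ = 1) :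
    (joukowski D (p.map Complex.ofRealHom)).eval z = (p.eval z.re : ℝ) * z ^ D := by
  have h1 := mul_conj_of_norm_eq_one hz
  have h2 : conj z * z = 1 := by rw [mul_comm, h1]
  have h := aeval_joukowski (natDegree_map_le.trans hp : (p.map Complex.ofRealHom).natDegree ≤ D)
    h1 h2
  have h3 : (1 / 2 : ℂ) • (z + conj z) = (z.re : ℂ) := by
    rw [Complex.add_conj, smul_eq_mul]
    push_cast
    ring
  have h4 : aeval (z.re : ℂ) (p.map Complex.ofRealHom) = ((p.eval z.re : ℝ) : ℂ) := by
    rw [coe_aeval_eq_eval, eval_map]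
    exact eval₂_at_apply Complex.ofRealHom z.re
  rw [h3, h4, coe_aeval_eq_eval] at h
  rw [← h, mul_assoc, ← mul_pow, h2, one_pow, mul_one]

/-- Polynomials of `2 H² - 1` that are less than one in absolute value on `[-1, 1]` can be block
encoded with a number of uses of the block encoding of `H` proportional to the degree. -/
theorem exists_circuit_eval (k D : ℕ) (p : ℝ[X]) (hp : p.natDegree ≤ D)
    (hlt : ∀ x ∈ Set.Icc (-1 : ℝ) 1, |p.eval x| < 1) :
    ∃ c : Circuit k (numWires k), c.queryCount = 6 * D ∧
      c.size ≤ 3 * D * (44 * k + 5) + 3 ∧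
      ∀ (ι : Type*) [Fintype ι] [DecidableEq ι] (H : Matrix ι ι ℂ) (hH : H.IsHermitian)
        (U : Matrix (Bits k × ι) (Bits k × ι) ℂ), IsBlockEncoding U H →
        IsBlockEncoding (c.eval U) (spectralOp hH fun lam => p.eval (2 * lam ^ 2 - 1)) := by
  set pc := p.map Complex.ofRealHom with hpc
  have hpc' : pc.natDegree ≤ D := natDegree_map_le.trans hp
  set A := joukowski D pc with hA
  have hAz : ∀ z : ℂ, ‖z‖ = 1 → A.eval z = (p.eval z.re : ℝ) * z ^ D :=
    fun z hz => joukowski_eval hp hz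
  have hre : ∀ z : ℂ, ‖z‖ = 1 → |p.eval z.re| < 1 := fun z hz =>
    hlt _ (abs_le.mp (hz ▸ Complex.abs_re_le_norm z))
  -- Fejér–Riesz applied to `1 - p (Re z) ^ 2`, which is positive because `|p| < 1` is strict.
  have hQ : ∃ B : ℂ[X], B.natDegree ≤ 2 * D ∧
      ∀ z : ℂ, ‖z‖ = 1 → ‖A.eval z‖ ^ 2 + ‖B.eval z‖ ^ 2 = 1 := by
    have hev : ∀ z : ℂ, ‖z‖ = 1 → (X ^ (2 * D) - joukowski (2 * D) (pc ^ 2)).eval z =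
        ((1 - p.eval z.re ^ 2 : ℝ) : ℂ) * z ^ (2 * D) := by
      intro z hz
      have hp2 : (p ^ 2).natDegree ≤ 2 * D := natDegree_pow_le.trans (Nat.mul_le_mul_left 2 hp)
      have := joukowski_eval hp2 hz
      rw [Polynomial.map_pow, ← hpc] at this
      rw [eval_sub, this, eval_pow, eval_X, eval_pow]
      push_cast
      ring
    obtain ⟨B, hB, hB'⟩ := exists_norm_sq_eval_eq (2 * D)
      (X ^ (2 * D) - joukowski (2 * D) (pc ^ 2))
      ((natDegree_sub_le_of_le ((natDegree_X_pow_le _).trans (by omega))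
        (joukowski_natDegree_le _ _)).trans (max_self _).le) fun z hz =>
        ⟨1 - p.eval z.re ^ 2, by
          have := (sq_lt_one_iff_abs_lt_one _).mpr (hre z hz)
          linarith, hev z hz⟩
    refine ⟨B, hB, fun z hz => ?_⟩
    have h := hB' z hz
    have hz0 : z ≠ 0 := by
      rintro rfl
      simp at hz
    rw [hev z hz] at h
    have h' := mul_right_cancel₀ (pow_ne_zero _ hz0) h
    rw [Complex.ofReal_inj] at h'
    rw [h', hAz z hz, norm_mul, norm_pow, hz, one_pow, mul_one, Complex.norm_real,
      Real.norm_eq_abs, sq_abs]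
    ring
  obtain ⟨B, hB, hAB⟩ := hQ
  obtain ⟨c₁, hq₁, hl₁, hc₁⟩ := exists_circuit_of_reachable k
    (reachable_of_norm_sq_add_norm_sq (2 * D) A B (joukowski_natDegree_le D pc) hB hAB)
  obtain ⟨c₂, hq₂, hl₂, hc₂⟩ := exists_circuit_walkInv_pow k D
  refine ⟨c₂ ++ c₁, ?_, ?_, ?_⟩
  · rw [queryCount_append, hq₁, hq₂]
    ring
  · rw [Circuit.size, List.length_append]
    nlinarith
  · intro ι _ _ H hH U hU
    refine isBlockEncoding_iff.mpr ⟨Circuit.eval_mem_unitaryGroup hU.1 _, ?_⟩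
    rw [spectralOp_eval, ← embed_false_mul_ancillaZero, Circuit.eval_append]
    -- The factor `walkInv U ^ D` cancels the shift `z ^ D` in `A`, leaving `p` of the symmetrised
    -- walk. The `B` branch carries signal `1` and is orthogonal to the output sector.
    have h1 : Circuit.eval U c₁ * Circuit.eval U c₂ * embed ι k false =
        embed ι k false * aeval ((1 / 2 : ℂ) • (walk U + walkInv U)) pc +
          embed ι k true * (aeval (walk U) B * walkInv U ^ D) := by
      rw [Matrix.mul_assoc, hc₂ ι U, ← Matrix.mul_assoc, hc₁ ι U hU.1, Matrix.add_mul,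
        Matrix.mul_assoc, Matrix.mul_assoc, aeval_joukowski hpc' (walk_mul_walkInv hU.1)
        (walkInv_mul_walk hU.1)]
    rw [← Matrix.mul_assoc _ (embed ι k false), h1, Matrix.conjTranspose_mul, Matrix.add_mul,
      Matrix.mul_assoc _ (embed ι k false)ᴴ, Matrix.mul_add, Matrix.mul_assoc (embed ι k false),
      Matrix.mul_assoc (embed ι k true), ← Matrix.mul_assoc (embed ι k false)ᴴ,
      ← Matrix.mul_assoc (embed ι k false)ᴴ, embed_conjTranspose_mul_embed,
      embed_conjTranspose_mul_embed, if_pos rfl, if_neg (by decide), Matrix.zero_mul, add_zero,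
      Matrix.one_mul, aeval_mul_eq_mul_aeval (walk_add_walkInv_mul_ancillaZero hH hU),
      ← Matrix.mul_assoc, conjTranspose_ancillaZero_mul_ancillaZero, Matrix.one_mul]

end BlockEncodedPolynomials

/-! ### Smoothing of indicator functions by trigonometric kernels -/

section Kernel

open Polynomial ComplexConjugate

theorem norm_sq_aeval {b : ℝ[X]} {N : ℕ} (hb : b.natDegree < N) (w : ℂ) :
    ‖aeval w b‖ ^ 2 = ∑ s ∈ Finset.range N, ∑ t ∈ Finset.range N,
      b.coeff s * b.coeff t * (w ^ s * conj w ^ t).re := by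
  have h : ((‖aeval w b‖ ^ 2 : ℝ) : ℂ) = ∑ s ∈ Finset.range N, ∑ t ∈ Finset.range N,
      ((b.coeff s * b.coeff t : ℝ) : ℂ) * (w ^ s * conj w ^ t) := by
    push_cast
    rw [← Complex.mul_conj', aeval_eq_sum_range' hb, map_sum, Finset.sum_mul_sum]
    refine Finset.sum_congr rfl fun s _ => Finset.sum_congr rfl fun t _ => ?_
    simp only [Complex.real_smul, map_mul, map_pow, Complex.conj_ofReal]
    ring
  have h' := congrArg Complex.re h
  simpa only [Complex.ofReal_re, Complex.re_sum, Complex.re_ofReal_mul] using h'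

/-- Parseval's identity on a shifted grid of roots of unity. -/
theorem sum_norm_sq_aeval {b : ℝ[X]} {N : ℕ} (hb : b.natDegree < N) {ζ : ℂ}
    (hζ : IsPrimitiveRoot ζ N) {z : ℂ} (hz : ‖z‖ = 1) :
    ∑ j ∈ Finset.range N, ‖aeval (z * ζ ^ j) b‖ ^ 2 =
      N * ∑ s ∈ Finset.range N, b.coeff s ^ 2 := by
  have hN : N ≠ 0 := by omega
  have hζ1 : ‖ζ‖ = 1 := Complex.norm_eq_one_of_pow_eq_one hζ.pow_eq_one hN
  have horth : ∀ s ∈ Finset.range N, ∀ t ∈ Finset.range N,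
      ∑ j ∈ Finset.range N, ((z * ζ ^ j) ^ s * conj (z * ζ ^ j) ^ t).re =
        if s = t then (N : ℝ) else 0 := by
    intro s hs t ht
    rw [← Complex.re_sum]
    have h1 : ∑ j ∈ Finset.range N, (z * ζ ^ j) ^ s * conj (z * ζ ^ j) ^ t =
        z ^ s * conj z ^ t * ∑ j ∈ Finset.range N, (ζ ^ s * conj ζ ^ t) ^ j := by
      rw [Finset.mul_sum]
      refine Finset.sum_congr rfl fun j _ => ?_
      rw [map_mul, map_pow]
      ring
    rw [h1]
    split_ifs with hst
    · subst hst
      rw [← mul_pow, ← mul_pow, mul_conj_of_norm_eq_one hz, mul_conj_of_norm_eq_one hζ1]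
      simp
    -- Distinct exponents below `N` give distinct powers of `ζ`, so the geometric sum runs over a
    -- nontrivial root of unity and vanishes.
    · have hne : ζ ^ s * conj ζ ^ t - 1 ≠ 0 := by
        intro h
        have h2 : ζ ^ s = ζ ^ t := by
          calc ζ ^ s = ζ ^ s * conj ζ ^ t * ζ ^ t := by
                rw [mul_assoc, ← mul_pow, mul_comm (conj ζ), mul_conj_of_norm_eq_one hζ1, one_pow,
                  mul_one]
            _ = ζ ^ t := by rw [sub_eq_zero.mp h, one_mul]
        exact hst (hζ.pow_inj (Finset.mem_range.mp hs) (Finset.mem_range.mp ht) h2)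
      have h3 : ∑ j ∈ Finset.range N, (ζ ^ s * conj ζ ^ t) ^ j = 0 := by
        refine (mul_eq_zero.mp ?_).resolve_left hne
        rw [mul_geom_sum, mul_pow, ← pow_mul, ← pow_mul, mul_comm s, mul_comm t, pow_mul, pow_mul,
          hζ.pow_eq_one, ← map_pow, hζ.pow_eq_one]
        simp
      rw [h3, mul_zero, Complex.zero_re]
  simp only [norm_sq_aeval hb]
  rw [Finset.sum_comm, Finset.mul_sum]
  refine Finset.sum_congr rfl fun s hs => ?_
  rw [Finset.sum_comm]
  calc _ = ∑ t ∈ Finset.range N, b.coeff s * b.coeff t * if s = t then (N : ℝ) else 0 := by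
        refine Finset.sum_congr rfl fun t ht => ?_
        rw [← Finset.mul_sum, horth s hs t ht]
    _ = N * b.coeff s ^ 2 := by
        rw [Finset.sum_eq_single s]
        · rw [if_pos rfl]
          ring
        · intro t _ hts
          rw [if_neg hts.symm, mul_zero]
        · exact fun h => absurd hs h

/-- The even part of the sum of `‖b (z ζ ^ j)‖ ^ 2` over `j ∈ J`, as a polynomial in `Re z`. -/
noncomputable def gridPolynomial (b : ℝ[X]) (N : ℕ) (ζ : ℂ) (J : Finset ℕ) : ℝ[X] :=
  ∑ j ∈ J, ∑ s ∈ Finset.range N, ∑ t ∈ Finset.range N,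
    C (b.coeff s * b.coeff t * ((ζ ^ j) ^ s * conj (ζ ^ j) ^ t).re) *
      Chebyshev.T ℝ ((s : ℤ) - t)

theorem gridPolynomial_natDegree_le (b : ℝ[X]) (N : ℕ) (ζ : ℂ) (J : Finset ℕ) :
    (gridPolynomial b N ζ J).natDegree ≤ N := by
  refine natDegree_sum_le_of_forall_le _ _ fun j _ => natDegree_sum_le_of_forall_le _ _ fun s hs =>
    natDegree_sum_le_of_forall_le _ _ fun t ht => (natDegree_C_mul_le _ _).trans ?_
  rw [Finset.mem_range] at hs ht
  rw [natDegree_le_iff_degree_le, Chebyshev.degree_T, Nat.cast_le]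
  omega

/-- A single kernel value need not be even in `φ`; averaging over `z` and `conj z` keeps only the
cosines, and `cos ((s - t) φ)` is a Chebyshev polynomial in `cos φ`. -/
theorem gridPolynomial_eval_cos {b : ℝ[X]} {N : ℕ} (hb : b.natDegree < N) (ζ : ℂ) (J : Finset ℕ)
    (φ : ℝ) {z : ℂ} (hz : z = Complex.exp (φ * Complex.I)) :
    (gridPolynomial b N ζ J).eval (Real.cos φ) =
      (∑ j ∈ J, ‖aeval (z * ζ ^ j) b‖ ^ 2 + ∑ j ∈ J, ‖aeval (conj z * ζ ^ j) b‖ ^ 2) / 2 := by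
  have hz1 : ‖z‖ = 1 := by rw [hz, Complex.norm_exp_ofReal_mul_I]
  have hcos : ∀ s t : ℕ, (Chebyshev.T ℝ ((s : ℤ) - t)).eval (Real.cos φ) =
      (z ^ s * conj z ^ t).re := by
    intro s t
    have h1 : z ^ s * conj z ^ t = Complex.exp ((((s : ℤ) - t : ℤ) * φ : ℝ) * Complex.I) := by
      rw [← Complex.inv_eq_conj hz1, hz, ← Complex.exp_neg, ← Complex.exp_nat_mul,
        ← Complex.exp_nat_mul, ← Complex.exp_add]
      congr 1
      push_cast
      ring
    rw [h1, Complex.exp_ofReal_mul_I_re, Chebyshev.T_real_cos]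
  rw [eq_div_iff two_ne_zero, ← Finset.sum_add_distrib, gridPolynomial, eval_finsetSum,
    Finset.sum_mul]
  refine Finset.sum_congr rfl fun j _ => ?_
  rw [norm_sq_aeval hb, norm_sq_aeval hb, eval_finsetSum, Finset.sum_mul,
    ← Finset.sum_add_distrib]
  refine Finset.sum_congr rfl fun s _ => ?_
  rw [eval_finsetSum, Finset.sum_mul, ← Finset.sum_add_distrib]
  refine Finset.sum_congr rfl fun t _ => ?_
  rw [eval_mul, eval_C, hcos]
  have h1 : (z * ζ ^ j) ^ s * conj (z * ζ ^ j) ^ t =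
      (z ^ s * conj z ^ t) * ((ζ ^ j) ^ s * conj (ζ ^ j) ^ t) := by
    rw [map_mul]
    ring
  have h2 : (conj z * ζ ^ j) ^ s * conj (conj z * ζ ^ j) ^ t =
      conj (z ^ s * conj z ^ t) * ((ζ ^ j) ^ s * conj (ζ ^ j) ^ t) := by
    simp only [map_mul, map_pow, Complex.conj_conj]
    ring
  rw [h1, h2]
  generalize (ζ ^ j) ^ s * conj (ζ ^ j) ^ t = u
  generalize z ^ s * conj z ^ t = v
  rw [Complex.mul_re, Complex.mul_re, Complex.conj_re, Complex.conj_im]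
  ring

/-- The polynomial `(1 + X + ⋯ + X ^ (n - 1)) / n`. -/
noncomputable def boxPolynomial (n : ℕ) : ℝ[X] := C (n : ℝ)⁻¹ * ∑ i ∈ Finset.range n, X ^ i

theorem boxPolynomial_natDegree_le (n : ℕ) : (boxPolynomial n).natDegree ≤ n - 1 := by
  refine (natDegree_C_mul_le _ _).trans (natDegree_sum_le_of_forall_le _ _ fun i hi => ?_)
  rw [natDegree_X_pow]
  have := Finset.mem_range.mp hi
  omega

theorem boxPolynomial_coeff (n i : ℕ) :
    (boxPolynomial n).coeff i = if i < n then (n : ℝ)⁻¹ else 0 := by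
  rw [boxPolynomial, coeff_C_mul, finsetSum_coeff]
  simp [coeff_X_pow]

theorem boxPolynomial_eval_one {n : ℕ} (hn : n ≠ 0) : (boxPolynomial n).eval 1 = 1 := by
  have : (n : ℝ) ≠ 0 := Nat.cast_ne_zero.mpr hn
  simp [boxPolynomial, eval_finsetSum, this]

/-- The geometric sum telescopes against `w - 1`. This is the decay of the kernel away from `1`. -/
theorem norm_sub_one_mul_norm_aeval_boxPolynomial_le (n : ℕ) {w : ℂ} (hw : ‖w‖ = 1) :
    ‖w - 1‖ * ‖aeval w (boxPolynomial n)‖ ≤ 2 / n := by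
  have h : (w - 1) * aeval w (boxPolynomial n) = (n : ℂ)⁻¹ * (w ^ n - 1) := by
    rw [← mul_geom_sum, boxPolynomial, map_mul, aeval_C, map_sum]
    simp only [map_pow, aeval_X, Complex.coe_algebraMap]
    push_cast
    ring
  rw [← norm_mul, h, norm_mul, norm_inv, Complex.norm_natCast, div_eq_mul_inv, mul_comm]
  refine mul_le_mul_of_nonneg_right ((norm_sub_le _ _).trans ?_) (by positivity)
  rw [norm_pow, hw, one_pow, norm_one]
  norm_num

theorem sum_norm_sq_aeval_boxPolynomial {n N : ℕ} (hn : n ≠ 0) (hN : n ≤ N) {ζ : ℂ}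
    (hζ : IsPrimitiveRoot ζ N) {z : ℂ} (hz : ‖z‖ = 1) :
    ∑ j ∈ Finset.range N, ‖aeval (z * ζ ^ j) (boxPolynomial n)‖ ^ 2 = N / n := by
  have hn' : (n : ℝ) ≠ 0 := Nat.cast_ne_zero.mpr hn
  have hdeg := boxPolynomial_natDegree_le n
  rw [sum_norm_sq_aeval (by omega) hζ hz]
  simp only [boxPolynomial_coeff, ite_pow, zero_pow two_ne_zero]
  rw [← Finset.sum_filter]
  have : (Finset.range N).filter (· < n) = Finset.range n := by
    ext i
    simp only [Finset.mem_filter, Finset.mem_range]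
    omega
  rw [this, Finset.sum_const, Finset.card_range, nsmul_eq_mul]
  field_simp

/-- Indicator functions on `[0, 1]` can be approximated, away from their jumps, by polynomials of
`2 λ² - 1`. Here `w` is the width of the jumps. -/
theorem exists_polynomial_approx (G : Set ℝ) {n m : ℕ} (hm : m ≠ 0) {w : ℝ}
    (hn : 16 ≤ n * w) :
    ∃ p : ℝ[X], p.natDegree ≤ m * n ∧ ∀ lam ∈ Set.Icc (0 : ℝ) 1,
      p.eval (2 * lam ^ 2 - 1) ∈ Set.Icc (0 : ℝ) 1 ∧
      ((∀ μ ∈ G, w / 2 ≤ |lam - μ|) → p.eval (2 * lam ^ 2 - 1) ≤ m * (1 / 64) ^ (m - 1)) ∧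
      ((∀ μ ∉ G, w / 2 ≤ |lam - μ|) → 1 - m * (1 / 64) ^ (m - 1) ≤ p.eval (2 * lam ^ 2 - 1)) := by
  classical
  have hn0 : n ≠ 0 := by
    rintro rfl
    norm_num at hn
  set N := m * n with hN
  have hN0 : N ≠ 0 := mul_ne_zero hm hn0
  have hNpos : (0 : ℝ) < N := Nat.cast_pos.mpr (Nat.pos_of_ne_zero hN0)
  have hnpos : (0 : ℝ) < n := Nat.cast_pos.mpr (Nat.pos_of_ne_zero hn0)
  have hζ := Complex.isPrimitiveRoot_exp N hN0
  set ζ := Complex.exp (2 * Real.pi * Complex.I / N)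
  have hζ1 : ‖ζ‖ = 1 := Complex.norm_eq_one_of_pow_eq_one hζ.pow_eq_one hN0
  set b := boxPolynomial n ^ m with hb
  have hbdeg : b.natDegree < N := by
    have h1 : b.natDegree ≤ m * (n - 1) :=
      natDegree_pow_le.trans (Nat.mul_le_mul_left m (boxPolynomial_natDegree_le n))
    refine h1.trans_lt (Nat.mul_lt_mul_of_pos_left ?_ (Nat.pos_of_ne_zero hm))
    omega
  -- `T` is the total mass of the kernel, the same at every `z`; dividing by it puts the values into
  -- `[0, 1]`. That `T ≥ 1` is Cauchy–Schwarz applied to `b 1 = 1`.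
  set T : ℝ := N * ∑ s ∈ Finset.range N, b.coeff s ^ 2 with hT
  have hT1 : 1 ≤ T := by
    have h1 : ∑ s ∈ Finset.range N, b.coeff s = 1 := by
      have : b.eval 1 = 1 := by
        rw [hb, eval_pow, boxPolynomial_eval_one hn0, one_pow]
      rw [eval_eq_sum_range' hbdeg] at this
      simpa using this
    have h2 := sq_sum_le_card_mul_sum_sq (s := Finset.range N) (f := fun s => b.coeff s)
    rwa [h1, one_pow, Finset.card_range] at h2
  have hT0 : 0 < T := one_pos.trans_le hT1
  have htotal : ∀ z : ℂ, ‖z‖ = 1 → ∑ j ∈ Finset.range N, ‖aeval (z * ζ ^ j) b‖ ^ 2 = T :=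
    fun z hz => sum_norm_sq_aeval hbdeg hζ hz
  -- At distance at least `w` the box polynomial is at most `2 / (n w) ≤ 1 / 8`. All but one of the
  -- `m` squared factors are bounded by `1 / 64`, and the last one sums to `N / n = m`.
  have htail : ∀ (z : ℂ) (K : Finset ℕ), ‖z‖ = 1 → K ⊆ Finset.range N →
      (∀ j ∈ K, w ≤ ‖z * ζ ^ j - 1‖) →
      ∑ j ∈ K, ‖aeval (z * ζ ^ j) b‖ ^ 2 ≤ m * (1 / 64) ^ (m - 1) := by
    intro z K hz hK hfar
    calc ∑ j ∈ K, ‖aeval (z * ζ ^ j) b‖ ^ 2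
        ≤ ∑ j ∈ K, (1 / 64) ^ (m - 1) * ‖aeval (z * ζ ^ j) (boxPolynomial n)‖ ^ 2 := by
          refine Finset.sum_le_sum fun j hj => ?_
          have h1 := norm_sub_one_mul_norm_aeval_boxPolynomial_le n (w := z * ζ ^ j)
            (by rw [norm_mul, norm_pow, hz, hζ1, one_pow, one_mul])
          have h2 : ‖aeval (z * ζ ^ j) (boxPolynomial n)‖ ≤ 1 / 8 := by
            rw [le_div_iff₀ hnpos] at h1
            have h3 := hfar j hj
            have h4 := norm_nonneg (aeval (z * ζ ^ j) (boxPolynomial n))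
            nlinarith [mul_le_mul_of_nonneg_right h3 (mul_nonneg h4 hnpos.le)]
          have h5 : ‖aeval (z * ζ ^ j) (boxPolynomial n)‖ ^ 2 ≤ 1 / 64 := by
            nlinarith [norm_nonneg (aeval (z * ζ ^ j) (boxPolynomial n))]
          rw [hb, map_pow, norm_pow, ← pow_mul, mul_comm m, pow_mul]
          conv_lhs => rw [← Nat.sub_add_cancel (Nat.one_le_iff_ne_zero.mpr hm), pow_succ]
          gcongr
      _ = (1 / 64) ^ (m - 1) * ∑ j ∈ K, ‖aeval (z * ζ ^ j) (boxPolynomial n)‖ ^ 2 :=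
          (Finset.mul_sum _ _ _).symm
      _ ≤ (1 / 64) ^ (m - 1) *
          ∑ j ∈ Finset.range N, ‖aeval (z * ζ ^ j) (boxPolynomial n)‖ ^ 2 := by
          gcongr
      _ = m * (1 / 64) ^ (m - 1) := by
          rw [sum_norm_sq_aeval_boxPolynomial hn0
            (Nat.le_mul_of_pos_left n (Nat.pos_of_ne_zero hm)) hζ hz]
          push_cast
          field_simp
  -- The map `z ↦ |1 + z| / 2` is Lipschitz with constant `1 / 2`, so values `w / 2` apart come from
  -- points of the circle at least `w` apart.
  have hdist : ∀ (z : ℂ) (j : ℕ) (lam : ℝ), ‖z‖ = 1 → lam = ‖1 + z‖ / 2 →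
      w / 2 ≤ |lam - ‖1 + conj (ζ ^ j)‖ / 2| → w ≤ ‖z * ζ ^ j - 1‖ := by
    intro z j lam hz hlam hfar
    have hj : ‖ζ ^ j‖ = 1 := by rw [norm_pow, hζ1, one_pow]
    have h1 : ‖z * ζ ^ j - 1‖ = ‖(1 + z) - (1 + conj (ζ ^ j))‖ := by
      have : z * ζ ^ j - 1 = ((1 + z) - (1 + conj (ζ ^ j))) * ζ ^ j := by
        linear_combination mul_conj_of_norm_eq_one hj
      rw [this, norm_mul, hj, mul_one]
    have h2 := abs_norm_sub_norm_le (1 + z) (1 + conj (ζ ^ j))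
    rw [h1]
    rw [hlam, ← sub_div, abs_div, abs_two] at hfar
    linarith
  -- The grid point `conj (ζ ^ j)`, at which the `j`-th kernel is centred, is selected according to
  -- whether its `λ` value lies in `G`.
  set J := (Finset.range N).filter fun j => ‖1 + conj (ζ ^ j)‖ / 2 ∈ G with hJ
  set J' := (Finset.range N).filter fun j => ¬ ‖1 + conj (ζ ^ j)‖ / 2 ∈ G with hJ'
  refine ⟨C T⁻¹ * gridPolynomial b N ζ J,
    (natDegree_C_mul_le _ _).trans (gridPolynomial_natDegree_le _ _ _ _), fun lam hlam => ?_⟩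
  have hy1 : -1 ≤ 2 * lam ^ 2 - 1 := by nlinarith [hlam.1]
  have hy2 : 2 * lam ^ 2 - 1 ≤ 1 := by nlinarith [hlam.1, hlam.2]
  set φ := Real.arccos (2 * lam ^ 2 - 1)
  have hcos : Real.cos φ = 2 * lam ^ 2 - 1 := Real.cos_arccos hy1 hy2
  set z := Complex.exp (φ * Complex.I) with hz
  have hz1 : ‖z‖ = 1 := Complex.norm_exp_ofReal_mul_I φ
  have hz1' : ‖conj z‖ = 1 := by rw [Complex.norm_conj, hz1]
  have hzlam : lam = ‖1 + z‖ / 2 := by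
    have h1 : ‖1 + z‖ ^ 2 = (2 * lam) ^ 2 := by
      have h2 : z.re = 2 * lam ^ 2 - 1 := by
        rw [hz, Complex.exp_ofReal_mul_I_re, hcos]
      have h3 := Complex.normSq_add 1 z
      rw [Complex.normSq_eq_norm_sq, Complex.normSq_eq_norm_sq, Complex.normSq_eq_norm_sq, hz1,
        one_mul, Complex.conj_re, h2, norm_one] at h3
      rw [h3]
      ring
    have h4 := (pow_left_inj₀ (norm_nonneg _) (by linarith [hlam.1]) two_ne_zero).mp h1
    rw [h4]
    ring
  have hzlam' : lam = ‖1 + conj z‖ / 2 := by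
    rw [hzlam, ← Complex.norm_conj (1 + z), map_add, map_one]
  have heval : (C T⁻¹ * gridPolynomial b N ζ J).eval (2 * lam ^ 2 - 1) =
      T⁻¹ * ((∑ j ∈ J, ‖aeval (z * ζ ^ j) b‖ ^ 2 + ∑ j ∈ J, ‖aeval (conj z * ζ ^ j) b‖ ^ 2) / 2) := by
    rw [eval_mul, eval_C, ← hcos, gridPolynomial_eval_cos hbdeg ζ J φ hz]
  have hsplit : ∀ u : ℂ, ‖u‖ = 1 → ∑ j ∈ J, ‖aeval (u * ζ ^ j) b‖ ^ 2 +
      ∑ j ∈ J', ‖aeval (u * ζ ^ j) b‖ ^ 2 = T := fun u hu => by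
    rw [← htotal u hu, hJ, hJ', Finset.sum_filter_add_sum_filter_not]
  have hnonneg : ∀ (u : ℂ) (K : Finset ℕ), 0 ≤ ∑ j ∈ K, ‖aeval (u * ζ ^ j) b‖ ^ 2 :=
    fun u K => Finset.sum_nonneg fun j _ => by positivity
  have hTi : T⁻¹ ≤ 1 := inv_le_one_of_one_le₀ hT1
  have hTi0 : 0 < T⁻¹ := inv_pos.mpr hT0
  have hTT : T⁻¹ * T = 1 := inv_mul_cancel₀ hT0.ne'
  set S₁ := ∑ j ∈ J, ‖aeval (z * ζ ^ j) b‖ ^ 2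
  set S₂ := ∑ j ∈ J, ‖aeval (conj z * ζ ^ j) b‖ ^ 2
  have hs1 := hsplit z hz1
  have hs2 := hsplit (conj z) hz1'
  have hp1 := hnonneg z J
  have hp2 := hnonneg (conj z) J
  have hp3 := hnonneg z J'
  have hp4 := hnonneg (conj z) J'
  rw [heval]
  refine ⟨⟨by positivity, ?_⟩, fun hfar => ?_, fun hfar => ?_⟩
  · rw [← hTT]
    exact mul_le_mul_of_nonneg_left (by linarith) hTi0.le
  · have h1 := htail z J hz1 (Finset.filter_subset _ _) fun j hj =>
      hdist z j lam hz1 hzlam (hfar _ (Finset.mem_filter.mp hj).2)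
    have h2 := htail (conj z) J hz1' (Finset.filter_subset _ _) fun j hj =>
      hdist (conj z) j lam hz1' hzlam' (hfar _ (Finset.mem_filter.mp hj).2)
    calc _ ≤ 1 * ((S₁ + S₂) / 2) := mul_le_mul_of_nonneg_right hTi (by positivity)
      _ ≤ _ := by linarith
  · have h1 := htail z J' hz1 (Finset.filter_subset _ _) fun j hj =>
      hdist z j lam hz1 hzlam (hfar _ (Finset.mem_filter.mp hj).2)
    have h2 := htail (conj z) J' hz1' (Finset.filter_subset _ _) fun j hj =>
      hdist (conj z) j lam hz1' hzlam' (hfar _ (Finset.mem_filter.mp hj).2)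
    have h3 : T⁻¹ * (T - (S₁ + S₂) / 2) ≤ 1 * (T - (S₁ + S₂) / 2) :=
      mul_le_mul_of_nonneg_right hTi (by linarith)
    rw [mul_sub, hTT] at h3
    linarith

end Kernel

/-! ### Attenuation operators -/

-- Truncating by `w / 2` centres the smoothed jumps in the transition regions: points outside `M`
-- and points of the promise truncated by `w` are both `w / 2` away from the jump. Half of `δ` pays
-- for the smoothing, and half for the factor `1 - δ / 2`, which makes `|p| < 1` strict.
open Polynomial in
theorem exists_attenuation_polynomial (M : RoundingPromise) {w δ : ℝ} {n m : ℕ} (hδ : 0 < δ)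
    (hδ1 : δ < 1) (hm : m ≠ 0) (hn : 16 ≤ n * w) (hmδ : m * (1 / 64 : ℝ) ^ (m - 1) ≤ δ / 2) :
    ∃ p : ℝ[X], p.natDegree ≤ m * n ∧ (∀ x ∈ Set.Icc (-1 : ℝ) 1, |p.eval x| < 1) ∧
      ∀ lam ∈ Set.Icc (0 : ℝ) 1, p.eval (2 * lam ^ 2 - 1) ∈ Set.Icc (0 : ℝ) 1 ∧
        (lam ∉ M.union → p.eval (2 * lam ^ 2 - 1) ≤ δ) ∧
        (lam ∈ M.truncatedUnion w → 1 - δ ≤ p.eval (2 * lam ^ 2 - 1)) := by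
  obtain ⟨p, hdeg, hp⟩ := exists_polynomial_approx (M.truncatedUnion (w / 2)) hm hn
  have heval : ∀ x, (C (1 - δ / 2) * p).eval x = (1 - δ / 2) * p.eval x := fun x => by
    rw [eval_mul, eval_C]
  refine ⟨C (1 - δ / 2) * p, (natDegree_C_mul_le _ _).trans hdeg, fun x hx => ?_, fun lam hlam => ?_⟩
  · have h0 : 0 ≤ (x + 1) / 2 := by linarith [hx.1]
    -- Every `x` in `[-1, 1]` is `2 λ² - 1` for this `λ` in `[0, 1]`.
    have h := (hp √((x + 1) / 2) ⟨Real.sqrt_nonneg _, Real.sqrt_le_iff.mpr ⟨zero_le_one, by linarith [hx.2]⟩⟩).1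
    rw [Real.sq_sqrt h0, show 2 * ((x + 1) / 2) - 1 = x by ring] at h
    rw [heval, abs_of_nonneg (mul_nonneg (by linarith) h.1)]
    nlinarith [h.1, h.2]
  · obtain ⟨h1, h2, h3⟩ := hp lam hlam
    rw [heval]
    refine ⟨⟨mul_nonneg (by linarith) h1.1, by nlinarith [h1.1, h1.2]⟩, fun hM => ?_, fun hM => ?_⟩
    · have h := h2 fun μ hμ => by
        obtain ⟨x, hx⟩ := Set.mem_iUnion.mp hμ
        by_contra! hlt
        rw [abs_lt] at hlt
        exact hM (Set.mem_iUnion.mpr ⟨x, by linarith [hx.1], by linarith [hx.2]⟩)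
      nlinarith [h1.1]
    · have h := h3 fun μ hμ => by
        obtain ⟨x, hx⟩ := Set.mem_iUnion.mp hM
        by_contra! hlt
        rw [abs_lt] at hlt
        exact hμ (Set.mem_iUnion.mpr ⟨x, by linarith [hx.1], by linarith [hx.2]⟩)
      nlinarith [h1.2]

/-! ### Choice of the degree, sharpening, and assembly. -/

theorem mul_one_div_pow_le_exp (j : ℕ) :
    ((j + 2 : ℕ) : ℝ) * (1 / 64) ^ (j + 1) ≤ Real.exp (-j) := by
  have h1 : ((j + 2 : ℕ) : ℝ) ≤ 2 ^ (j + 1) := by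
    exact_mod_cast (Nat.lt_two_pow_self : j + 1 < 2 ^ (j + 1))
  have h2 : (1 / 32 : ℝ) ≤ Real.exp (-1) := by
    rw [Real.exp_neg, one_div]
    exact inv_anti₀ (Real.exp_pos 1) (by linarith [Real.exp_one_lt_d9])
  calc ((j + 2 : ℕ) : ℝ) * (1 / 64) ^ (j + 1) ≤ 2 ^ (j + 1) * (1 / 64) ^ (j + 1) := by gcongr
    _ = (1 / 32) ^ (j + 1) := by rw [← mul_pow]; norm_num
    _ ≤ (1 / 32) ^ j := pow_le_pow_of_le_one (by norm_num) (by norm_num) (Nat.le_succ j)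
    _ ≤ Real.exp (-1) ^ j := by gcongr
    _ = Real.exp (-j) := by rw [← Real.exp_nat_mul]; ring_nf

theorem RoundingPromise.truncatedUnion_subset_union (M : RoundingPromise) {w : ℝ} (hw : 0 ≤ w) :
    M.truncatedUnion w ⊆ M.union :=
  Set.iUnion_mono fun _ => Set.Icc_subset_Icc (by linarith) (by linarith)

open Classical in
/-- The function that is sharp outside the transition regions and equals `a'` inside them. -/
noncomputable def sharpen (M : RoundingPromise) (w : ℝ) (a' : ℝ → ℝ) (lam : ℝ) : ℝ :=
  if lam ∉ M.union then 0 else if lam ∈ M.truncatedUnion w then 1 else a' lam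

theorem sharpen_of_notMem {M : RoundingPromise} {w : ℝ} {a' : ℝ → ℝ} {lam : ℝ}
    (h : lam ∉ M.union) : sharpen M w a' lam = 0 := if_pos h

theorem sharpen_of_mem_truncatedUnion {M : RoundingPromise} {w : ℝ} (hw : 0 ≤ w) {a' : ℝ → ℝ}
    {lam : ℝ} (h : lam ∈ M.truncatedUnion w) : sharpen M w a' lam = 1 := by
  rw [sharpen, if_neg (not_not.mpr (M.truncatedUnion_subset_union hw h)), if_pos h]

theorem sharpen_of_mem_of_notMem {M : RoundingPromise} {w : ℝ} {a' : ℝ → ℝ} {lam : ℝ}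
    (h : lam ∈ M.union) (h' : lam ∉ M.truncatedUnion w) : sharpen M w a' lam = a' lam := by
  rw [sharpen, if_neg (not_not.mpr h), if_neg h']

theorem sharpen_mem_Icc {M : RoundingPromise} {w : ℝ} {a' : ℝ → ℝ} {lam : ℝ}
    (h : a' lam ∈ Set.Icc (0 : ℝ) 1) : sharpen M w a' lam ∈ Set.Icc (0 : ℝ) 1 := by
  rw [sharpen]
  split_ifs
  · exact ⟨zero_le_one, le_rfl⟩
  · exact h
  · exact ⟨le_rfl, zero_le_one⟩

theorem abs_sharpen_sub_le {M : RoundingPromise} {w δ : ℝ} (hw : 0 ≤ w) (hδ : 0 ≤ δ) {a' : ℝ → ℝ}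
    {lam : ℝ} (h : a' lam ∈ Set.Icc (0 : ℝ) 1) (h0 : lam ∉ M.union → a' lam ≤ δ)
    (h1 : lam ∈ M.truncatedUnion w → 1 - δ ≤ a' lam) : |sharpen M w a' lam - a' lam| ≤ δ := by
  by_cases hM : lam ∈ M.union
  · by_cases hT : lam ∈ M.truncatedUnion w
    · rw [sharpen_of_mem_truncatedUnion hw hT, abs_of_nonneg (by linarith [h.2])]
      linarith [h1 hT]
    · rw [sharpen_of_mem_of_notMem hM hT, sub_self, abs_zero]
      exact hδ
  · rw [sharpen_of_notMem hM, zero_sub, abs_neg, abs_of_nonneg h.1]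
    exact h0 hM

theorem isBlockEncoding_one {ι : Type*} [Fintype ι] [DecidableEq ι] (k : ℕ) :
    IsBlockEncoding (1 : Matrix (Bits k × ι) (Bits k × ι) ℂ) 1 := by
  refine ⟨one_mem _, ?_⟩
  ext s t
  simp [Matrix.one_apply]

theorem RoundingPromise.union_eq_of_s_lt_two (M : RoundingPromise) (hs : M.s < 2) {lam : ℝ}
    (hlam : lam ∈ Set.Icc (0 : ℝ) 1) : lam ∈ M.union := by
  have h1 := M.left_first
  have h2 := M.right_last
  have h3 : (⟨M.s - 1, Nat.sub_lt M.s_pos Nat.one_pos⟩ : Fin M.s) = ⟨0, M.s_pos⟩ :=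
    Fin.ext (by simp; omega)
  rw [h3] at h2
  exact Set.mem_iUnion.mpr ⟨⟨0, M.s_pos⟩, h1 ▸ hlam.1, h2 ▸ hlam.2⟩

/-- The parameters of the attenuation polynomial and the resulting degree. -/
theorem exists_degree_parameters {w δ L : ℝ} (hw : 0 < w) (hw1 : w ≤ 1) (hδ : 0 < δ)
    (hL : 1 / 2 ≤ L) (hLδ : Real.log (2 / δ) ≤ L) :
    ∃ n m : ℕ, m ≠ 0 ∧ n ≠ 0 ∧ 16 ≤ n * w ∧ m * (1 / 64 : ℝ) ^ (m - 1) ≤ δ / 2 ∧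
      ((m * n : ℕ) : ℝ) ≤ 119 * (w⁻¹ * L) := by
  have hn : 16 / w ≤ (⌈16 / w⌉₊ : ℝ) := Nat.le_ceil _
  have hn' : (⌈16 / w⌉₊ : ℝ) ≤ 17 * w⁻¹ := by
    have h1 := (Nat.ceil_lt_add_one (by positivity : 0 ≤ 16 / w)).le
    have h2 := (one_le_inv₀ hw).mpr hw1
    rw [div_eq_mul_inv] at h1 ⊢
    linarith
  have hj : Real.log (2 / δ) ≤ (⌈Real.log (2 / δ)⌉₊ : ℝ) := Nat.le_ceil _
  have hj' : (⌈Real.log (2 / δ)⌉₊ : ℝ) ≤ L + 1 :=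
    (Nat.cast_le.mpr (Nat.ceil_mono hLδ)).trans (Nat.ceil_lt_add_one (by linarith)).le
  set n := ⌈16 / w⌉₊
  set j := ⌈Real.log (2 / δ)⌉₊
  -- With `m = j + 2` the tail is at most `exp (-j) ≤ δ / 2`. The constant 119 is `7 * 17`: `j + 2 ≤
  -- L + 3 ≤ 7 L` because `L ≥ 1 / 2`, and `n ≤ 17 / w` because `w ≤ 1`.
  refine ⟨n, j + 2, by omega, ?_, (div_le_iff₀ hw).mp hn, ?_, ?_⟩
  · have : 0 < 16 / w := by positivity
    exact (Nat.ceil_pos.mpr this).ne'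
  · refine (mul_one_div_pow_le_exp j).trans ?_
    calc Real.exp (-j) ≤ Real.exp (-Real.log (2 / δ)) := Real.exp_le_exp.mpr (by linarith)
      _ = δ / 2 := by rw [Real.exp_neg, Real.exp_log (by positivity), inv_div]
  · push_cast
    calc ((j : ℝ) + 2) * n ≤ (7 * L) * (17 * w⁻¹) := by
          gcongr
          linarith
      _ = 119 * (w⁻¹ * L) := by ring

universe u

theorem exists_attenuation_function (M : RoundingPromise) (κ γ δ : ℝ) (hκ : 0 < κ) (hγ : 0 < γ)
    (hκγ : κ * γ ≤ 1) (hδ : 0 < δ) :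
    ∃ a' : ℝ → ℝ,
      (∀ lam ∈ Set.Icc (0 : ℝ) 1, a' lam ∈ Set.Icc (0 : ℝ) 1 ∧ (lam ∉ M.union → a' lam ≤ δ) ∧
        (lam ∈ M.truncatedUnion (κ * γ) → 1 - δ ≤ a' lam)) ∧
      ∀ k : ℕ, ∃ (q : ℕ) (c : Circuit k q),
        (c.queryCount : ℝ) ≤ 16065 * (κ⁻¹ * γ⁻¹ * max 0 (Real.log (M.s / δ))) ∧
        (c.size : ℝ) ≤ 16065 * (k + 1) * (κ⁻¹ * γ⁻¹ * max 0 (Real.log (M.s / δ))) ∧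
        ∀ (ι : Type u) [Fintype ι] [DecidableEq ι] (H : Matrix ι ι ℂ) (hH : H.IsHermitian)
          (U : Matrix (Bits k × ι) (Bits k × ι) ℂ), IsBlockEncoding U H →
          IsBlockEncoding (c.eval U) (spectralOp hH a') := by
  -- In these cases the gate bound can be zero or arbitrarily small, so no gate may be spent. The
  -- constant 1 is admissible: either `M` covers `[0, 1]`, or leakage up to 1 is allowed.
  by_cases htriv : M.s < 2 ∨ 1 ≤ δ
  · refine ⟨fun _ => 1, fun lam hlam => ⟨⟨zero_le_one, le_rfl⟩, fun hM => ?_, fun _ => by linarith⟩,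
      fun k => ⟨0, [], ?_, ?_, fun ι _ _ H hH U _ => ?_⟩⟩
    · rcases htriv with hs | hδ1
      · exact absurd (M.union_eq_of_s_lt_two hs hlam) hM
      · exact hδ1
    · simp only [Circuit.queryCount, List.countP_nil, Nat.cast_zero]
      positivity
    · simp only [Circuit.size, List.length_nil, Nat.cast_zero]
      positivity
    · rw [spectralOp_const, Complex.ofReal_one, one_smul]
      exact isBlockEncoding_one 0
  · push Not at htriv
    obtain ⟨hs, hδ1⟩ := htriv
    have hs' : (2 : ℝ) ≤ M.s := by exact_mod_cast hs
    set L := Real.log (M.s / δ) with hL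
    have hLδ : Real.log (2 / δ) ≤ L := Real.log_le_log (by positivity) (by gcongr)
    have hL2 : 1 / 2 ≤ L := by
      have h1 : Real.log 2 ≤ Real.log (2 / δ) :=
        Real.log_le_log (by norm_num) (by rw [le_div_iff₀ hδ]; linarith)
      linarith [Real.log_two_gt_d9]
    obtain ⟨n, m, hm, hn0, hn, hmδ, hmn⟩ :=
      exists_degree_parameters (mul_pos hκ hγ) hκγ hδ hL2 hLδ
    obtain ⟨p, hdeg, hlt, hp⟩ := exists_attenuation_polynomial M hδ hδ1 hm hn hmδ
    refine ⟨fun lam => p.eval (2 * lam ^ 2 - 1), hp, fun k => ?_⟩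
    obtain ⟨c, hq, hsz, hc⟩ := exists_circuit_eval k (m * n) p hdeg hlt
    rw [max_eq_right (by linarith : 0 ≤ L), ← mul_inv]
    have hmn1 : (1 : ℝ) ≤ ((m * n : ℕ) : ℝ) := by
      exact_mod_cast Nat.one_le_iff_ne_zero.mpr (mul_ne_zero hm hn0)
    refine ⟨numWires k, c, ?_, ?_, hc⟩
    · rw [hq, Nat.cast_mul]
      push_cast at hmn hmn1 ⊢
      linarith
    · have h1 : (c.size : ℝ) ≤ 3 * ((m * n : ℕ) : ℝ) * (44 * k + 5) + 3 := by exact_mod_cast hsz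
      have hk : (0 : ℝ) ≤ k := Nat.cast_nonneg k
      calc (c.size : ℝ) ≤ 3 * ((m * n : ℕ) : ℝ) * (44 * k + 5) + 3 := h1
        -- As `m n ≥ 1`, the additive 3 is absorbed: `132 k + 18 ≤ 135 (k + 1)`. The final constant
        -- is `135 * 119 = 16065`.
        _ ≤ 135 * (k + 1) * ((m * n : ℕ) : ℝ) := by nlinarith
        _ ≤ 135 * (k + 1) * (119 * ((κ * γ)⁻¹ * L)) := by gcongr
        _ = 16065 * (k + 1) * ((κ * γ)⁻¹ * L) := by ring

theorem mainTheorem10 :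
    ∃ C : ℝ, 0 < C ∧
      ∀ (M : RoundingPromise) (κ γ δ : ℝ), 0 < κ → 0 < γ → κ * γ ≤ 1 → 0 < δ →
        M.WidthsAtLeast κ →
        ∃ a a' : ℝ → ℝ,
          Set.MapsTo a (Set.Icc 0 1) (Set.Icc 0 1) ∧
          Set.MapsTo a' (Set.Icc 0 1) (Set.Icc 0 1) ∧
          (∀ lam ∈ Set.Icc (0 : ℝ) 1,
            (lam ∉ M.union → a lam = 0 ∧ a' lam ≤ δ) ∧
            (lam ∈ M.truncatedUnion (κ * γ) → a lam = 1 ∧ 1 - δ ≤ a' lam) ∧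
            (lam ∈ M.union → lam ∉ M.truncatedUnion (κ * γ) → a lam = a' lam)) ∧
          (∀ (ι : Type*) [Fintype ι] [DecidableEq ι] (H : Matrix ι ι ℂ) (hH : H.IsHermitian),
            (∀ i, hH.eigenvalues i ∈ Set.Icc (0 : ℝ) 1) →
            Commute (spectralOp hH a) H ∧
            Commute (spectralOp hH a') H ∧
            ‖spectralOp hH a - spectralOp hH a'‖ ≤ δ ∧
            ‖spectralOp hH a * (1 - promisedProj hH M)‖ = 0) ∧
          (∀ k : ℕ, ∃ (q : ℕ) (c : Circuit k q),
            (c.queryCount : ℝ) ≤ C * (κ⁻¹ * γ⁻¹ * max 0 (Real.log (M.s / δ))) ∧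
            (c.size : ℝ) ≤ C * (k + 1) * (κ⁻¹ * γ⁻¹ * max 0 (Real.log (M.s / δ))) ∧
            ∀ (ι : Type*) [Fintype ι] [DecidableEq ι] (H : Matrix ι ι ℂ) (hH : H.IsHermitian),
              (∀ i, hH.eigenvalues i ∈ Set.Icc (0 : ℝ) 1) →
              ∀ U : Matrix (Bits k × ι) (Bits k × ι) ℂ, IsBlockEncoding U H →
                IsBlockEncoding (c.eval U) (spectralOp hH a')) := by
  refine ⟨16065, by norm_num, fun M κ γ δ hκ hγ hκγ hδ _ => ?_⟩
  obtain ⟨a', ha', hc⟩ := exists_attenuation_function M κ γ δ hκ hγ hκγ hδ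
  have hw : 0 ≤ κ * γ := (mul_pos hκ hγ).le
  refine ⟨sharpen M (κ * γ) a', a', fun lam hlam => sharpen_mem_Icc (ha' lam hlam).1,
    fun lam hlam => (ha' lam hlam).1, fun lam hlam => ?_, fun ι _ _ H hH hev => ?_, fun k => ?_⟩
  · exact ⟨fun h => ⟨sharpen_of_notMem h, (ha' lam hlam).2.1 h⟩,
      fun h => ⟨sharpen_of_mem_truncatedUnion hw h, (ha' lam hlam).2.2 h⟩,
      fun h h' => sharpen_of_mem_of_notMem h h'⟩
  · refine ⟨commute_spectralOp hH _, commute_spectralOp hH _, ?_, ?_⟩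
    · rw [spectralOp_sub]
      refine norm_spectralOp_le hH _ hδ.le fun i => ?_
      obtain ⟨h1, h2, h3⟩ := ha' _ (hev i)
      exact abs_sharpen_sub_le hw hδ.le h1 h2 h3
    · rw [spectralOp_mul_one_sub_promisedProj hH M fun i h => sharpen_of_notMem h, norm_zero]
  · obtain ⟨q, c, hq, hs, hc⟩ := hc k
    exact ⟨q, c, hq, hs, fun ι _ _ H hH _ U hU => hc ι H hH U hU⟩
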